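/- Let $\Sigma$ be a finite alphabet with $|\Sigma|\ge 2$, let $n\ge 0$ be an integer and let $p\in(0,1]$. Model. Let $x\in\Sigma^n$ be a uniformly random string, and generate a random string $y$ from $x$ by the insertion-deletion process $G_p$, as follows (all random choices are independent of each other and of $x$). Start with pointers $i=j=1$ and repeat: with probability $1-p$ set $A^p(i)=j$ and increment both $i$ and $j$; with probability $p/2$ set $A^p(i)=\bot$ and increment $i$ (deletion); with probability $p/2$ increment $j$ (insertion). The process ends when all of $x$ has been processed, that is, when $i$ first equals $n+1$ (which happens almost surely); if $j=m+1$ at that moment, then $y$ has length $m$. For each $j\in\{1,\dots,m\}$, put $y[j]=x[i]$ if $A^p(i)=j$ for some $i$, and otherwise let $y[j]$ be an independent uniformly random symbol of $\Sigma$. Edit distance. An alignment of strings $x\in\Sigma^n$ and $y\in\Sigma^m$ is a map $A:\{1,\dots,n\}\to\{1,\dots,m\}\cup\{\bot\}$ that is strictly increasing on $\{i: A(i)\ne\bot\}$ and satisfies $x[i]=y[A(i)]$ whenever $A(i)\ne\bot$; its cost is the number of positions of $x$ and of $y$ that it leaves unmatched. $\operatorname{ED}(x,y)$ is the minimum cost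 of an alignment of $x$ and $y$ (so it counts insertions and deletions, not substitutions). Lemma. For every real $\varepsilon$ with $p\le\varepsilon$ and $15\,p\log_2\frac1p\le\varepsilon\le\frac16$, $$\Pr\bigl[\operatorname{ED}(x,y)<(1-6\varepsilon)\,p\,n\bigr]\le 2e^{-\varepsilon^2p^2n/2}.$$ -/

import Mathlib

open MeasureTheory

/-! ### Alignments and edit distance

Strings of length `n` over the alphabet `α` are functions `Fin n → α`; the symbol `⊥` ("unmatched")
is `none`. -/

/-- `A` is an alignment between the strings `x` and `y`: it is increasing on its support and it only
matches positions that carry equal symbols. -/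
structure IsAlignment {α : Type*} {n m : ℕ} (x : Fin n → α) (y : Fin m → α)
    (A : Fin n → Option (Fin m)) : Prop where
  increasing : ∀ i i' j j', i < i' → A i = some j → A i' = some j' → j < j'
  matching : ∀ i j, A i = some j → x i = y j

/-- The cost of an alignment: the number of positions of the first string and of the second string
that it leaves unmatched. -/
noncomputable def alignmentCost {n m : ℕ} (A : Fin n → Option (Fin m)) : ℕ :=
  Nat.card {i : Fin n // A i = none} + Nat.card {j : Fin m // ∀ i, A i ≠ some j}

/-- The edit distance (insertions and deletions): the minimum cost of an alignment. The set is
non-empty, since matching nothing is an alignment. -/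
noncomputable def editDistance {α : Type*} {n m : ℕ} (x : Fin n → α) (y : Fin m → α) : ℕ :=
  sInf {c : ℕ | ∃ A : Fin n → Option (Fin m), IsAlignment x y A ∧ alignmentCost A = c}

/-! ### The generative model, first stage: the planted alignment

Positions are counted from `0`. -/

/-- The three possible steps of the insertion-deletion process. -/
inductive EditOp : Type
  | keep
  | delete
  | insert

instance : MeasurableSpace EditOp := ⊤

/-- The law of one step: keep with probability `1 - p`, delete with probability `p / 2`, insert with
probability `p / 2`. -/
noncomputable def editOpLaw (p : unitInterval) : Measure EditOp :=
  ENNReal.ofReal (1 - p) • Measure.dirac EditOp.keep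
    + ENNReal.ofReal (p / 2) • Measure.dirac EditOp.delete
    + ENNReal.ofReal (p / 2) • Measure.dirac EditOp.insert

instance (p : unitInterval) : IsProbabilityMeasure (editOpLaw p) := by
  constructor
  have h0 : (0 : ℝ) ≤ p := p.2.1
  have h1 : (0 : ℝ) ≤ 1 - p := sub_nonneg.2 p.2.2
  simp only [editOpLaw, Measure.add_apply, Measure.smul_apply, measure_univ, smul_eq_mul, mul_one]
  rw [← ENNReal.ofReal_add h1 (by positivity), ← ENNReal.ofReal_add (by positivity) (by positivity)]
  rw [← ENNReal.ofReal_one]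
  congr 1
  ring

/-- The pair `(i, j)` of current positions in the input and in the output string after `t` steps. -/
def pointers (s : ℕ → EditOp) : ℕ → ℕ × ℕ
  | 0 => (0, 0)
  | t + 1 =>
    match s t with
    | EditOp.keep => ((pointers s t).1 + 1, (pointers s t).2 + 1)
    | EditOp.delete => ((pointers s t).1 + 1, (pointers s t).2)
    | EditOp.insert => ((pointers s t).1, (pointers s t).2 + 1)

open Classical in
/-- The planted alignment: `i` is mapped to `j` if some step taken at the positions `(i, j)` is a
`keep` (for each `i` there is at most one such `j`), and to `none` otherwise. -/
noncomputable def plantedAlignment (s : ℕ → EditOp) (i : ℕ) : Option ℕ :=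
  if h : ∃ j t, pointers s t = (i, j) ∧ s t = EditOp.keep then some h.choose else none

/-- The length of the output at the moment when the first `n` input positions have been processed,
i.e. when the input pointer first equals `n` (almost surely this happens). -/
noncomputable def outputLength (s : ℕ → EditOp) (n : ℕ) : ℕ :=
  sInf {j : ℕ | ∃ t, pointers s t = (n, j)}

/-! ### The generative model, second stage: the symbols -/

open Classical in
/-- The trace produced from the base string `x` of length `n`, the step sequence `s` and the symbols
`a` available for insertion: the symbol at `j` is `x i` if the planted alignment maps `i` to `j`, and
it is the inserted symbol `a j` if there is no such `i`. -/
noncomputable def indelTrace {α : Type*} {n : ℕ} (s : ℕ → EditOp) (a : ℕ → α) (x : Fin n → α) :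
    Fin (outputLength s n) → α :=
  fun j => if h : ∃ i : Fin n, plantedAlignment s i = some (j : ℕ) then x h.choose else a j

/-- The joint law of all the randomness: independent steps `s 0, s 1, …` with law `editOpLaw p`,
independent uniformly random symbols `a 0, a 1, …` for the insertions, and a uniformly random base
string of length `n`, these three being independent of each other. -/
noncomputable def modelLaw (α : Type*) [Fintype α] [Nonempty α] [MeasurableSpace α]
    (p : unitInterval) (n : ℕ) : Measure ((ℕ → EditOp) × (ℕ → α) × (Fin n → α)) :=
  (Measure.infinitePi fun _ : ℕ => editOpLaw p).prod
    ((Measure.infinitePi fun _ : ℕ => (PMF.uniformOfFintype α).toMeasure).prod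
      (PMF.uniformOfFintype (Fin n → α)).toMeasure)

/-! Fix the edit operations and the inserted symbols, and count the base strings `x` that lie close
to their trace. Call an insertion or deletion isolated if no other error is within distance `2 * K`,
where `K` is about `2 * logb 2 (1 / p)`. Isolated errors carry disjoint windows of input positions,
and the planted shift changes by one in the middle of each. With `X = p * n`, outside an event of
small probability there are about `W = (1 - 2 * ε) * X` such windows.

Suppose an alignment has cost at most `C = (1 - 6 * ε) * X`. It leaves at least `W - C` windows
intact, meaning that it shifts each of them rigidly, and the successive differences of these shifts
have absolute values summing to at most `C`. The intact windows and these differences form a code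
(`IsAlignment.exists_code`). No single shift agrees with the planted alignment on both halves of a
window, so each intact window imposes at least `K` equations between a symbol of `x` and a trace
symbol other than its planted partner (`le_card_planted_ne`). Since both alignments are increasing,
these equations contain no cycle and act as independent constraints (`eq_of_constraints`). A code
with `m` intact windows is therefore realised by at most a `2 ^ (-K * m)` fraction of the strings.

The union bound over codes uses exponential weights that factor over the windows
(`card_editDistance_le`). As `2 ^ (-K) ≤ p ^ 2`, the sum over codes costs only a factor `exp (W * ε
/ 1000)`, while having at least `W - C ≈ 4 * ε * X` intact windows gains `exp (-(W - C))`.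

Only the first `n` steps are examined, so the input pointer stays at most `n` and no stopping time
enters. The tail bounds for all errors and for crowded errors come from one exponential
supermartingale (`integral_exp_errorPotential_le`). -/

open ProbabilityTheory

/-! ### Alignments as rigid shifts on windows -/

/-- An alignment is described by two counting functions: `u k` counts the unmatched positions of the
first string below `k`, and `v k` the unmatched positions of the second string that lie to the left
of the partner of a position below `k`. -/
theorem IsAlignment.exists_profile {α : Type*} {n m : ℕ} {x : Fin n → α} {y : Fin m → α}
    {A : Fin n → Option (Fin m)} (h : IsAlignment x y A) :
    ∃ u v : ℕ → ℕ, Monotone u ∧ Monotone v ∧ u 0 = 0 ∧ v 0 = 0 ∧ u n + v n ≤ alignmentCost A ∧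
      (∀ i : Fin n, A i = none → u i < u (i + 1)) ∧
      ∀ (i : Fin n) (j : Fin m), A i = some j → (j : ℕ) + u i = i + v (i + 1) := by
  classical
  let U : ℕ → Finset (Fin n) := fun k => {i : Fin n | (i : ℕ) < k ∧ A i = none}
  let V : ℕ → Finset (Fin m) := fun k =>
    {j : Fin m | (∀ i, A i ≠ some j) ∧ ∃ i' : Fin n, (i' : ℕ) < k ∧ ∃ j', A i' = some j' ∧ j < j'}
  refine ⟨fun k => (U k).card, fun k => (V k).card, ?_, ?_, ?_, ?_, ?_, ?_, ?_⟩
  · intro k l hkl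
    apply Finset.card_le_card
    intro i
    simp only [U, Finset.mem_filter, Finset.mem_univ, true_and]
    exact fun ⟨h1, h2⟩ => ⟨h1.trans_le hkl, h2⟩
  · intro k l hkl
    apply Finset.card_le_card
    intro i
    simp only [V, Finset.mem_filter, Finset.mem_univ, true_and]
    exact fun ⟨h1, i', h2, h3⟩ => ⟨h1, i', h2.trans_le hkl, h3⟩
  · simp [U]
  · simp [V]
  · unfold alignmentCost
    rw [Nat.card_eq_fintype_card, Nat.card_eq_fintype_card, Fintype.card_subtype,
      Fintype.card_subtype]
    apply Nat.add_le_add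
    · apply Finset.card_le_card
      intro i
      simp only [U, Finset.mem_filter, Finset.mem_univ, true_and]
      exact fun h => h.2
    · apply Finset.card_le_card
      intro i
      simp only [V, Finset.mem_filter, Finset.mem_univ, true_and]
      exact fun h => h.1
  · intro i hi
    apply Finset.card_lt_card
    rw [Finset.ssubset_iff_of_subset]
    · exact ⟨i, by simp [U, hi], by simp [U]⟩
    · intro i
      simp only [U, Finset.mem_filter, Finset.mem_univ, true_and]
      exact fun ⟨h1, h2⟩ => ⟨by omega, h2⟩
  · intro i j hij
    -- Position `i` is itself matched to `j`, and partners increase, so for `i + 1` being left of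
    -- some earlier partner means being below `j`.
    have hV : V (i + 1) = ({j' ∈ Finset.Iio j | ∀ i', A i' ≠ some j'} : Finset (Fin m)) := by
      ext j'
      simp only [V, Finset.mem_filter, Finset.mem_univ, true_and, Finset.mem_Iio]
      constructor
      · rintro ⟨h1, i', h2, j'', h3, h4⟩
        refine ⟨?_, h1⟩
        rcases (show i' ≤ i from Fin.le_def.2 (by omega)).lt_or_eq with h5 | h5
        · exact h4.trans (h.increasing _ _ _ _ h5 h3 hij)
        · subst h5
          rw [hij] at h3
          cases h3
          exact h4
      · rintro ⟨h1, h2⟩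
        exact ⟨h2, i, by omega, j, hij, h1⟩
    have hU : U i = ({i' ∈ Finset.Iio i | A i' = none} : Finset (Fin n)) := by
      ext i'
      simp only [U, Finset.mem_filter, Finset.mem_univ, true_and, Finset.mem_Iio, Fin.lt_def]
    -- `A` restricts to a bijection between the matched positions below `i` and those below `j`; the
    -- two counts are `i - u i` and `j - v (i + 1)`.
    have hc : ({i' ∈ Finset.Iio i | ¬ A i' = none} : Finset (Fin n)).card
        = ({j' ∈ Finset.Iio j | ¬ ∀ i', A i' ≠ some j'} : Finset (Fin m)).card := by
      have himg : ({i' ∈ Finset.Iio i | ¬ A i' = none} : Finset (Fin n)).image A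
        = ({j' ∈ Finset.Iio j | ¬ ∀ i', A i' ≠ some j'} : Finset (Fin m)).image some := by
        ext o
        simp only [Finset.mem_image, Finset.mem_filter, Finset.mem_Iio]
        constructor
        · rintro ⟨i', ⟨h1, h2⟩, rfl⟩
          obtain ⟨j', hj'⟩ := Option.ne_none_iff_exists'.1 h2
          exact ⟨j', ⟨h.increasing _ _ _ _ h1 hj' hij, by push Not; exact ⟨i', hj'⟩⟩, hj'.symm⟩
        · rintro ⟨j', ⟨h1, h2⟩, rfl⟩
          push Not at h2
          obtain ⟨i', hi'⟩ := h2
          refine ⟨i', ⟨?_, by simp [hi']⟩, hi'⟩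
          by_contra hlt
          rcases (not_lt.1 hlt).lt_or_eq with h5 | h5
          · exact absurd (h.increasing _ _ _ _ h5 hij hi') (not_lt.2 h1.le)
          · subst h5
            rw [hij] at hi'
            cases hi'
            exact lt_irrefl _ h1
      rw [← Finset.card_image_of_injective _ (Option.some_injective (Fin m)), ← himg,
        Finset.card_image_of_injOn]
      intro i1 h1 i2 h2 h12
      simp only [Finset.coe_filter, Finset.mem_Iio, Set.mem_ofPred_eq] at h1 h2
      obtain ⟨j', hj'⟩ := Option.ne_none_iff_exists'.1 h1.2
      have hj2 : A i2 = some j' := by rw [← hj', h12]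
      rcases lt_trichotomy i1 i2 with h3 | h3 | h3
      · exact absurd (h.increasing _ _ _ _ h3 hj' hj2) (lt_irrefl _)
      · exact h3
      · exact absurd (h.increasing _ _ _ _ h3 hj2 hj') (lt_irrefl _)
    have e1 := Finset.card_filter_add_card_filter_not (s := Finset.Iio i) (fun i' => A i' = none)
    have e2 := Finset.card_filter_add_card_filter_not (s := Finset.Iio j)
      (fun j' => ∀ i', A i' ≠ some j')
    rw [Fin.card_Iio] at e1 e2
    simp only [hV, hU]
    omega

/-- The partial sums of a sequence of optional integers, a missing entry counting as `0`. -/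
def shiftOf (f : ℕ → Option ℤ) (w : ℕ) : ℤ := ∑ k ∈ Finset.range (w + 1), (f k).getD 0

/-- A sequence `δ` whose increments are dominated by those of `Φ` is recorded at the places where
`bad` holds by differences of bounded total variation. -/
theorem exists_difference_code (δ : ℕ → ℤ) (Φ : ℕ → ℕ) (bad : ℕ → Prop)
    (h0 : ∀ w, |δ w| ≤ Φ w) (h1 : ∀ w w', w ≤ w' → |δ w' - δ w| ≤ (Φ w' : ℤ) - Φ w) :
    ∃ f : ℕ → Option ℤ, (∀ w, f w = none ↔ ¬ bad w) ∧ (∀ w, bad w → shiftOf f w = δ w) ∧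
      ∀ w, ∑ k ∈ Finset.range w, |(f k).getD 0| ≤ (Φ w : ℤ) := by
  classical
  -- `l w` is the last value recorded before `w`, starting from 0.
  let l : ℕ → ℤ := fun w => Nat.rec 0 (fun w x => if bad w then δ w else x) w
  have l0 : l 0 = 0 := rfl
  have ls : ∀ w, l (w + 1) = if bad w then δ w else l w := fun w => rfl
  let f : ℕ → Option ℤ := fun w => if bad w then some (δ w - l w) else none
  have hsum : ∀ w, ∑ k ∈ Finset.range w, (f k).getD 0 = l w := by
    intro w
    induction w with
    | zero => simp [l0]
    | succ w ih =>
      rw [Finset.sum_range_succ, ih, ls]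
      by_cases hb : bad w <;> simp [f, hb]
  -- The induction needs the pending jump from the last recorded value to any later `δ w'`, so that
  -- skipped places cost nothing extra.
  have hvar : ∀ w w', w ≤ w' →
      ∑ k ∈ Finset.range w, |(f k).getD 0| + |δ w' - l w| ≤ (Φ w' : ℤ) := by
    intro w
    induction w with
    | zero => intro w' _; simpa [l0] using h0 w'
    | succ w ih =>
      intro w' hw'
      rw [Finset.sum_range_succ, ls]
      by_cases hb : bad w
      · have i1 := ih w le_rfl
        have i2 := h1 w w' (by omega)
        simp only [f, hb, if_true, Option.getD_some] at i1 ⊢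
        linarith
      · have i1 := ih w' (by omega)
        simpa [f, hb] using i1
  refine ⟨f, fun w => by simp [f], fun w hb => ?_, fun w => ?_⟩
  · rw [shiftOf, hsum, ls, if_pos hb]
  · have := hvar w w le_rfl
    have := abs_nonneg (δ w - l w)
    linarith

/-- Along a sequence of consecutive windows, an alignment of small cost shifts most of the windows
rigidly, and the shifts have small total variation. -/
theorem IsAlignment.exists_code {α : Type*} {n m : ℕ} {x : Fin n → α} {y : Fin m → α}
    {A : Fin n → Option (Fin m)} (h : IsAlignment x y A) (lo hi : ℕ → ℕ)
    (h1 : ∀ w, lo w ≤ hi w) (h2 : ∀ w, hi w ≤ lo (w + 1)) (W : ℕ) (hW : lo W ≤ n) :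
    ∃ f : ℕ → Option ℤ,
      (∀ w, f w ≠ none → ∀ i : Fin n, lo w ≤ i → (i : ℕ) < hi w →
        ∃ j, A i = some j ∧ (j : ℤ) = i + shiftOf f w) ∧
      ∑ k ∈ Finset.range W, |(f k).getD 0| ≤ (alignmentCost A : ℤ) ∧
      W ≤ alignmentCost A + ({w ∈ Finset.range W | f w ≠ none} : Finset ℕ).card := by
  classical
  obtain ⟨u, v, hu, hv, hu0, hv0, huv, hnone, hsome⟩ := h.exists_profile
  have hlo : Monotone lo := monotone_nat_of_le_succ fun w => (h1 w).trans (h2 w)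
  obtain ⟨f, hf1, hf2, hf3⟩ := exists_difference_code
    (fun w => (v (lo w) : ℤ) - u (lo w)) (fun w => u (lo w) + v (lo w))
    -- In the role of `bad` stand the intact windows, where neither count grows. The common shift
    -- there is `v (lo w) - u (lo w)`.
    (fun w => u (hi w) = u (lo w) ∧ v (hi w) = v (lo w))
    (fun w => by push_cast; rw [abs_le]; constructor <;> linarith)
    (fun w w' hww => by
      have a1 : (u (lo w) : ℤ) ≤ u (lo w') := by exact_mod_cast hu (hlo hww)
      have a2 : (v (lo w) : ℤ) ≤ v (lo w') := by exact_mod_cast hv (hlo hww)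
      push_cast
      rw [abs_le]
      constructor <;> linarith)
  have hcost : u (lo W) + v (lo W) ≤ alignmentCost A :=
    (Nat.add_le_add (hu hW) (hv hW)).trans huv
  refine ⟨f, fun w hw i hi1 hi2 => ?_, (hf3 W).trans (by exact_mod_cast hcost), ?_⟩
  · have hb : u (hi w) = u (lo w) ∧ v (hi w) = v (lo w) := by
      by_contra hb
      exact hw ((hf1 w).2 hb)
    have e1 := hu hi1
    have e2 := hu (show (i : ℕ) + 1 ≤ hi w from hi2)
    have e3 := hu (Nat.le_succ (i : ℕ))
    have e4 := hv (show lo w ≤ (i : ℕ) + 1 by omega)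
    have e5 := hv (show (i : ℕ) + 1 ≤ hi w from hi2)
    simp only [Nat.succ_eq_add_one] at e3
    have hne : A i ≠ none := by
      intro hn
      have := hnone i hn
      omega
    obtain ⟨j, hj⟩ := Option.ne_none_iff_exists'.1 hne
    refine ⟨j, hj, ?_⟩
    have := hsome i j hj
    rw [hf2 w hb]
    omega
  -- Every window that is not intact raises `u + v` by at least one, and the windows are disjoint.
  · have key : ∀ k, ({w ∈ Finset.range k | ¬ f w ≠ none} : Finset ℕ).card
        ≤ u (lo k) + v (lo k) := by
      intro k
      induction k with
      | zero => simp
      | succ k ih =>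
        have a1 := hu (h1 k)
        have a2 := hv (h1 k)
        have a3 := hu (h2 k)
        have a4 := hv (h2 k)
        rw [Finset.range_add_one, Finset.filter_insert]
        by_cases hk : f k = none
        · rw [if_pos (not_not.2 hk), Finset.card_insert_of_notMem (by simp)]
          have : ¬ (u (hi k) = u (lo k) ∧ v (hi k) = v (lo k)) := (hf1 k).1 hk
          omega
        · rw [if_neg (not_not.2 hk)]
          omega
    have e1 := Finset.card_filter_add_card_filter_not (s := Finset.range W) (fun w => f w ≠ none)
    rw [Finset.card_range] at e1
    have := key W
    omega

/-! ### Pointers and the planted alignment -/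

theorem pointers_succ_keep {s : ℕ → EditOp} {t : ℕ} (h : s t = EditOp.keep) :
    pointers s (t + 1) = ((pointers s t).1 + 1, (pointers s t).2 + 1) := by
  rw [pointers, h]

theorem pointers_succ_delete {s : ℕ → EditOp} {t : ℕ} (h : s t = EditOp.delete) :
    pointers s (t + 1) = ((pointers s t).1 + 1, (pointers s t).2) := by
  rw [pointers, h]

theorem pointers_succ_insert {s : ℕ → EditOp} {t : ℕ} (h : s t = EditOp.insert) :
    pointers s (t + 1) = ((pointers s t).1, (pointers s t).2 + 1) := by
  rw [pointers, h]

theorem pointers_fst_mono (s : ℕ → EditOp) : Monotone fun t => (pointers s t).1 := by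
  refine monotone_nat_of_le_succ fun t => ?_
  rcases h : s t with _ | _ | _
  · simp [pointers_succ_keep h]
  · simp [pointers_succ_delete h]
  · simp [pointers_succ_insert h]

theorem pointers_snd_mono (s : ℕ → EditOp) : Monotone fun t => (pointers s t).2 := by
  refine monotone_nat_of_le_succ fun t => ?_
  rcases h : s t with _ | _ | _
  · simp [pointers_succ_keep h]
  · simp [pointers_succ_delete h]
  · simp [pointers_succ_insert h]

theorem pointers_fst_le (s : ℕ → EditOp) (t : ℕ) : (pointers s t).1 ≤ t := by
  induction t with
  | zero => simp [pointers]
  | succ t ih =>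
    rcases h : s t with _ | _ | _
    · simp [pointers_succ_keep h, ih]
    · simp [pointers_succ_delete h, ih]
    · simp only [pointers_succ_insert h]
      omega

theorem lt_of_pointers_lt {s : ℕ → EditOp} {t t' : ℕ} (h : s t = EditOp.keep) (h' : t < t') :
    (pointers s t).1 < (pointers s t').1 ∧ (pointers s t).2 < (pointers s t').2 := by
  have e1 := pointers_fst_mono s (show t + 1 ≤ t' from h')
  have e2 := pointers_snd_mono s (show t + 1 ≤ t' from h')
  simp only [pointers_succ_keep h] at e1 e2
  omega

theorem plantedAlignment_eq_some_iff {s : ℕ → EditOp} {i j : ℕ} :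
    plantedAlignment s i = some j ↔ ∃ t, pointers s t = (i, j) ∧ s t = EditOp.keep := by
  classical
  constructor
  · intro h
    unfold plantedAlignment at h
    split_ifs at h with h'
    cases h
    exact h'.choose_spec
  · rintro ⟨t, h1, h2⟩
    have h' : ∃ j t, pointers s t = (i, j) ∧ s t = EditOp.keep := ⟨j, t, h1, h2⟩
    unfold plantedAlignment
    rw [dif_pos h']
    obtain ⟨t', h3, h4⟩ := h'.choose_spec
    congr 1
    rcases lt_trichotomy t t' with h5 | h5 | h5
    · have := (lt_of_pointers_lt h2 h5).1
      rw [h1, h3] at this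
      exact absurd this (lt_irrefl _)
    · subst h5
      rw [h1] at h3
      exact (Prod.mk.inj h3).2.symm
    · have := (lt_of_pointers_lt h4 h5).1
      rw [h1, h3] at this
      exact absurd this (lt_irrefl _)

theorem plantedAlignment_strictMono {s : ℕ → EditOp} {i i' j j' : ℕ} (h : i < i')
    (hj : plantedAlignment s i = some j) (hj' : plantedAlignment s i' = some j') : j < j' := by
  obtain ⟨t, h1, h2⟩ := plantedAlignment_eq_some_iff.1 hj
  obtain ⟨t', h3, h4⟩ := plantedAlignment_eq_some_iff.1 hj'
  have hlt : t < t' := by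
    by_contra hle
    have := pointers_fst_mono s (not_lt.1 hle)
    simp only [h1, h3] at this
    omega
  have := (lt_of_pointers_lt h2 hlt).2
  rwa [h1, h3] at this

theorem pointers_add_of_keep {s : ℕ → EditOp} {t k : ℕ}
    (h : ∀ r < k, s (t + r) = EditOp.keep) :
    pointers s (t + k) = ((pointers s t).1 + k, (pointers s t).2 + k) := by
  induction k with
  | zero => rfl
  | succ k ih =>
    rw [← add_assoc, pointers_succ_keep (h k (by omega)), ih fun r hr => h r (by omega)]
    simp [add_assoc]

theorem plantedAlignment_of_keep {s : ℕ → EditOp} {t k r : ℕ}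
    (h : ∀ r < k, s (t + r) = EditOp.keep) (hr : r < k) :
    plantedAlignment s ((pointers s t).1 + r) = some ((pointers s t).2 + r) :=
  plantedAlignment_eq_some_iff.2
    ⟨t + r, pointers_add_of_keep fun r' hr' => h r' (hr'.trans hr), h r hr⟩

open Classical in
/-- Around an isolated edit operation no shift agrees with the planted alignment on both sides. -/
theorem le_card_planted_ne {s : ℕ → EditOp} {t K : ℕ} (hs : s (t + K) ≠ EditOp.keep)
    (hl : ∀ r < K, s (t + r) = EditOp.keep) (hr : ∀ r < K, s (t + K + 1 + r) = EditOp.keep)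
    (δ : ℤ) :
    K ≤ ({i ∈ Finset.Ico (pointers s t).1 (pointers s (t + K + 1 + K)).1 |
      ∀ j : ℕ, plantedAlignment s i = some j → (j : ℤ) ≠ i + δ} : Finset ℕ).card := by
  have hend := pointers_add_of_keep hr
  have hmid := pointers_add_of_keep hl
  have key : ∀ a b : ℕ, (pointers s t).1 ≤ a → a + K ≤ (pointers s (t + K + 1 + K)).1 →
      (∀ r < K, plantedAlignment s (a + r) = some (b + r)) → (b : ℤ) ≠ a + δ →
      K ≤ ({i ∈ Finset.Ico (pointers s t).1 (pointers s (t + K + 1 + K)).1 |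
        ∀ j : ℕ, plantedAlignment s i = some j → (j : ℤ) ≠ i + δ} : Finset ℕ).card := by
    intro a b h1 h2 h3 h4
    calc K = (Finset.Ico a (a + K)).card := by simp
      _ ≤ _ := by
        apply Finset.card_le_card
        intro i hi
        obtain ⟨hi1, hi2⟩ := Finset.mem_Ico.1 hi
        refine Finset.mem_filter.2 ⟨Finset.mem_Ico.2 ⟨by omega, by omega⟩, fun j hj => ?_⟩
        obtain ⟨r, rfl⟩ := Nat.exists_eq_add_of_le hi1
        rw [h3 r (by omega)] at hj
        cases hj
        push_cast
        omega
  -- The planted shift is constant on each half and changes by one at the error. If `δ` fits the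
  -- left half, the right half violates it; otherwise the left half does.
  by_cases hδ : ((pointers s t).2 : ℤ) = (pointers s t).1 + δ
  · have hsh : (pointers s t).1 + K ≤ (pointers s (t + K + 1)).1 ∧
        ((pointers s (t + K + 1)).2 : ℤ) ≠ (pointers s (t + K + 1)).1 + δ := by
      rcases h : s (t + K) with _ | _ | _
      · exact absurd h hs
      · rw [pointers_succ_delete h, hmid]
        push_cast
        omega
      · rw [pointers_succ_insert h, hmid]
        push_cast
        omega
    refine key (pointers s (t + K + 1)).1 (pointers s (t + K + 1)).2 (by omega) ?_
      (fun r h => plantedAlignment_of_keep hr h) hsh.2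
    rw [hend]
  · refine key _ _ le_rfl ?_ (fun r h => plantedAlignment_of_keep hl h) hδ
    have := pointers_fst_mono s (show t + K ≤ t + K + 1 + K by omega)
    simp only [hmid] at this
    exact this

/-! ### Strings constrained by non-planted equations -/

open Classical in
/-- The symbol at position `j` of the trace, for an arbitrary natural number `j`. -/
noncomputable def traceSymbol {α : Type*} {n : ℕ} (P : ℕ → Option ℕ) (a : ℕ → α) (x : Fin n → α)
    (j : ℕ) : α :=
  if h : ∃ i : Fin n, P i = some j then x h.choose else a j

theorem indelTrace_eq {α : Type*} {n : ℕ} (s : ℕ → EditOp) (a : ℕ → α) (x : Fin n → α) :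
    indelTrace s a x = fun j : Fin _ => traceSymbol (plantedAlignment s) a x (j : ℕ) := rfl

/-- Two strings which both satisfy a monotone system of equations with the trace, avoiding the
planted alignment, coincide as soon as they agree off the left-hand sides. -/
theorem eq_of_constraints {α : Type*} {n : ℕ} {P : ℕ → Option ℕ}
    (hP : ∀ i i' j j', i < i' → P i = some j → P i' = some j' → j < j') (a : ℕ → α)
    (D : Finset (Fin n)) (J : Fin n → ℕ) (hJ : ∀ i ∈ D, ∀ i' ∈ D, i < i' → J i < J i')
    (hne : ∀ i ∈ D, P i ≠ some (J i)) {x x' : Fin n → α}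
    (hx : ∀ i ∈ D, x i = traceSymbol P a x (J i)) (hx' : ∀ i ∈ D, x' i = traceSymbol P a x' (J i))
    (hxx : ∀ i ∉ D, x i = x' i) : x = x' := by
  classical
  -- The trace symbol at `J i` is either an inserted symbol, common to both strings, or is copied
  -- from its planted source `i'`.
  have step : ∀ i ∈ D, x i = x' i ∨ ∃ i' : Fin n, P i' = some (J i) ∧ (x i' = x' i' → x i = x' i) := by
    intro i hi
    by_cases h : ∃ i' : Fin n, P i' = some (J i)
    · right
      refine ⟨h.choose, h.choose_spec, fun h' => ?_⟩
      rw [hx i hi, hx' i hi, traceSymbol, traceSymbol, dif_pos h, dif_pos h, h']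
    · left
      rw [hx i hi, hx' i hi, traceSymbol, traceSymbol, dif_neg h, dif_neg h]
  have mono : ∀ i1 i2 : Fin n, ∀ j1 j2, P i1 = some j1 → P i2 = some j2 → j1 < j2 → i1 < i2 := by
    intro i1 i2 j1 j2 h1 h2 h12
    by_contra hle
    rcases (not_lt.1 hle).lt_or_eq with h3 | h3
    · exact absurd (hP _ _ _ _ h3 h2 h1) (not_lt.2 h12.le)
    · subst h3
      rw [h1] at h2
      cases h2
      exact lt_irrefl _ h12
  -- If the source of `i` lies to its right, monotonicity of `J` and `P` puts the source of that
  -- source further right. The chain rises until it reaches an inserted symbol or leaves `D`; `down`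
  -- is the mirror image.
  have up : ∀ k : ℕ, ∀ i : Fin n, n - i ≤ k →
      (∀ i' : Fin n, i ∈ D → P i' = some (J i) → i < i') → x i = x' i := by
    intro k
    induction k with
    | zero => intro i hi; have := i.2; omega
    | succ k ih =>
      intro i hi hup
      by_cases hD : i ∈ D
      · rcases step i hD with h | ⟨i', h1, h2⟩
        · exact h
        · have hii := hup i' hD h1
          have hii' := Fin.lt_def.1 hii
          exact h2 (ih i' (by omega) fun i'' hD' h3 => mono _ _ _ _ h1 h3 (hJ i hD i' hD' hii))
      · exact hxx i hD
  have down : ∀ k : ℕ, ∀ i : Fin n, (i : ℕ) < k →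
      (∀ i' : Fin n, i ∈ D → P i' = some (J i) → i' < i) → x i = x' i := by
    intro k
    induction k with
    | zero => intro i hi; omega
    | succ k ih =>
      intro i hi hdown
      by_cases hD : i ∈ D
      · rcases step i hD with h | ⟨i', h1, h2⟩
        · exact h
        · have hii := hdown i' hD h1
          have hii' := Fin.lt_def.1 hii
          exact h2 (ih i' (by omega) fun i'' hD' h3 => mono _ _ _ _ h3 h1 (hJ i' hD' i hD hii))
      · exact hxx i hD
  funext i
  by_cases h : ∀ i' : Fin n, i ∈ D → P i' = some (J i) → i < i'
  · exact up _ i le_rfl h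
  · push Not at h
    obtain ⟨i', hD, h1, h2⟩ := h
    refine down _ i (Nat.lt_succ_self _) fun i'' _ h3 => ?_
    have h12 : i' = i'' := by
      rcases lt_trichotomy i' i'' with h4 | h4 | h4
      · exact absurd (hP _ _ _ _ h4 h1 h3) (lt_irrefl _)
      · exact h4
      · exact absurd (hP _ _ _ _ h4 h3 h1) (lt_irrefl _)
    subst h12
    refine lt_of_le_of_ne h2 ?_
    rintro rfl
    exact hne _ hD h1

/-- By `eq_of_constraints`, restriction to the complement of `D` is injective on `S`, so each
constraint costs a full factor of the alphabet size. -/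
theorem card_constraints_mul_le {α : Type*} [Fintype α] {n : ℕ} {P : ℕ → Option ℕ}
    (hP : ∀ i i' j j', i < i' → P i = some j → P i' = some j' → j < j') (a : ℕ → α)
    (D : Finset (Fin n)) (J : Fin n → ℕ) (hJ : ∀ i ∈ D, ∀ i' ∈ D, i < i' → J i < J i')
    (hne : ∀ i ∈ D, P i ≠ some (J i)) (S : Set (Fin n → α))
    (hS : ∀ x ∈ S, ∀ i ∈ D, x i = traceSymbol P a x (J i)) :
    Nat.card S * Fintype.card α ^ D.card ≤ Fintype.card α ^ n := by
  classical
  have h1 : Nat.card S ≤ Nat.card ({i : Fin n // i ∉ D} → α) := by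
    refine Nat.card_le_card_of_injective (fun x i => x.1 i.1) fun x x' hxx => ?_
    refine Subtype.ext (eq_of_constraints hP a D J hJ hne (hS _ x.2) (hS _ x'.2) fun i hi => ?_)
    exact congrFun hxx ⟨i, hi⟩
  rw [Nat.card_eq_fintype_card (α := _ → α), Fintype.card_fun, Fintype.card_subtype_compl,
    Fintype.card_fin, Fintype.card_coe] at h1
  calc Nat.card S * Fintype.card α ^ D.card
      ≤ Fintype.card α ^ (n - D.card) * Fintype.card α ^ D.card := Nat.mul_le_mul_right _ h1
    _ = Fintype.card α ^ n := by
      rw [← pow_add, Nat.sub_add_cancel]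
      simpa using Finset.card_le_univ D

open Classical in
/-- Few strings admit an alignment with their trace which realises the shifts `f` on the
windows. -/
theorem card_code_mul_le {α : Type*} [Fintype α] {n : ℕ} (s : ℕ → EditOp) (a : ℕ → α)
    (lo hi : ℕ → ℕ) (h1 : ∀ w, lo w ≤ hi w) (h2 : ∀ w, hi w ≤ lo (w + 1)) (W K : ℕ)
    (hW : lo W ≤ n)
    (hK : ∀ w < W, ∀ δ : ℤ, K ≤ ({i ∈ Finset.Ico (lo w) (hi w) |
      ∀ j : ℕ, plantedAlignment s i = some j → (j : ℤ) ≠ i + δ} : Finset ℕ).card)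
    (f : ℕ → Option ℤ) :
    Nat.card {x : Fin n → α | ∃ A, IsAlignment x (indelTrace s a x) A ∧
      ∀ w < W, f w ≠ none → ∀ i : Fin n, lo w ≤ i → (i : ℕ) < hi w →
        ∃ j, A i = some j ∧ (j : ℤ) = i + shiftOf f w} *
      Fintype.card α ^ (K * ({w ∈ Finset.range W | f w ≠ none} : Finset ℕ).card)
      ≤ Fintype.card α ^ n := by
  set S := {x : Fin n → α | ∃ A, IsAlignment x (indelTrace s a x) A ∧
      ∀ w < W, f w ≠ none → ∀ i : Fin n, lo w ≤ i → (i : ℕ) < hi w →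
        ∃ j, A i = some j ∧ (j : ℤ) = i + shiftOf f w} with hS
  rcases S.eq_empty_or_nonempty with hemp | ⟨x₀, A₀, hA₀, hf₀⟩
  · simp [hemp]
  have hlo : Monotone lo := monotone_nat_of_le_succ fun w => (h1 w).trans (h2 w)
  let D : Finset (Fin n) := {i : Fin n | ∃ w < W, f w ≠ none ∧ lo w ≤ i ∧ (i : ℕ) < hi w ∧
    ∀ j : ℕ, plantedAlignment s i = some j → (j : ℤ) ≠ i + shiftOf f w}
  have hDmem : ∀ i, i ∈ D ↔ ∃ w < W, f w ≠ none ∧ lo w ≤ i ∧ (i : ℕ) < hi w ∧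
    ∀ j : ℕ, plantedAlignment s i = some j → (j : ℤ) ≠ i + shiftOf f w := by
    intro i; simp [D]
  -- The targets are read off one alignment `A₀`. On `D` they equal `i + shiftOf f w`, hence are the
  -- same for every string in `S`, and the default 0 is never used there.
  let J : Fin n → ℕ := fun i => ((A₀ i).map Fin.val).getD 0
  have hJA : ∀ i j, A₀ i = some j → J i = j := by
    intro i j hj
    simp [J, hj]
  have hcard : K * ({w ∈ Finset.range W | f w ≠ none} : Finset ℕ).card ≤ D.card := by
    let B : ℕ → Finset ℕ := fun w => {i ∈ Finset.Ico (lo w) (hi w) |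
      ∀ j : ℕ, plantedAlignment s i = some j → (j : ℤ) ≠ i + shiftOf f w}
    have hsub : ({w ∈ Finset.range W | f w ≠ none} : Finset ℕ).biUnion B ⊆
        D.map Fin.valEmbedding := by
      intro i hi'
      simp only [Finset.mem_biUnion, Finset.mem_filter, Finset.mem_range, B, Finset.mem_Ico] at hi'
      obtain ⟨w, ⟨hw, hfw⟩, ⟨hi1, hi2⟩, hi3⟩ := hi'
      have : i < n := hi2.trans_le ((h2 w).trans ((hlo hw).trans hW))
      exact Finset.mem_map.2 ⟨⟨i, this⟩, (hDmem _).2 ⟨w, hw, hfw, hi1, hi2, hi3⟩, rfl⟩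
    have hle := Finset.card_le_card hsub
    rw [Finset.card_map, Finset.card_biUnion] at hle
    · refine le_trans ?_ hle
      rw [mul_comm, ← smul_eq_mul]
      apply Finset.card_nsmul_le_sum
      intro w hw
      exact hK w (Finset.mem_range.1 (Finset.mem_filter.1 hw).1) _
    · intro w _ w' _ hww
      have aux : ∀ w w', w < w' → Disjoint (B w) (B w') := by
        intro w w' hww
        rw [Finset.disjoint_left]
        intro i hi1 hi2
        have e1 := (Finset.mem_Ico.1 (Finset.mem_filter.1 hi1).1).2
        have e2 := (Finset.mem_Ico.1 (Finset.mem_filter.1 hi2).1).1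
        have e3 := hlo (show w + 1 ≤ w' from hww)
        have e4 := h2 w
        omega
      rcases lt_or_gt_of_ne hww with h | h
      · exact aux _ _ h
      · exact (aux _ _ h).symm
  refine le_trans (Nat.mul_le_mul_left _
    (Nat.pow_le_pow_right (Fintype.card_pos_iff.2 ⟨a 0⟩) hcard)) ?_
  refine card_constraints_mul_le (P := plantedAlignment s) (fun i i' j j' h => plantedAlignment_strictMono h) a D J ?_ ?_ S ?_
  · intro i hi1 i' hi2 hii
    obtain ⟨w, hw, hfw, e1, e2, -⟩ := (hDmem i).1 hi1
    obtain ⟨w', hw', hfw', e1', e2', -⟩ := (hDmem i').1 hi2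
    obtain ⟨j, hj, -⟩ := hf₀ w hw hfw i e1 e2
    obtain ⟨j', hj', -⟩ := hf₀ w' hw' hfw' i' e1' e2'
    rw [hJA _ _ hj, hJA _ _ hj']
    exact hA₀.increasing _ _ _ _ hii hj hj'
  · intro i hi1 hP
    obtain ⟨w, hw, hfw, e1, e2, e3⟩ := (hDmem i).1 hi1
    obtain ⟨j, hj, hj'⟩ := hf₀ w hw hfw i e1 e2
    rw [hJA _ _ hj] at hP
    exact e3 _ hP hj'
  · rintro x ⟨A, hA, hf⟩ i hi1
    obtain ⟨w, hw, hfw, e1, e2, -⟩ := (hDmem i).1 hi1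
    obtain ⟨j, hj, hj'⟩ := hf w hw hfw i e1 e2
    obtain ⟨j₀, hj₀, hj₀'⟩ := hf₀ w hw hfw i e1 e2
    have := hA.matching i j hj
    rw [this, indelTrace_eq, hJA _ _ hj₀]
    congr 1
    omega

/-! ### The weighted union bound over codes -/

/-- A finite code, extended by `none` to all natural numbers. -/
def extendCode {W : ℕ} (F : Fin W → Option ℤ) (k : ℕ) : Option ℤ :=
  if h : k < W then F ⟨k, h⟩ else none

theorem shiftOf_congr {f g : ℕ → Option ℤ} {W w : ℕ} (h : ∀ k < W, f k = g k) (hw : w < W) :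
    shiftOf f w = shiftOf g w :=
  Finset.sum_congr rfl fun k hk => by
    have := Finset.mem_range.1 hk
    rw [h k (by omega)]

/-- The weight of a code letter. -/
noncomputable def codeWeight (r ε : ℝ) : Option ℤ → ℝ
  | none => 1
  | some d => r * Real.exp (-(ε * |d|))

theorem prod_codeWeight (r ε : ℝ) (f : ℕ → Option ℤ) (W : ℕ) :
    ∏ k ∈ Finset.range W, codeWeight r ε (f k) =
      r ^ ({w ∈ Finset.range W | f w ≠ none} : Finset ℕ).card *
        Real.exp (-(ε * (∑ k ∈ Finset.range W, |(f k).getD 0| : ℤ))) := by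
  induction W with
  | zero => simp
  | succ W ih =>
    rw [Finset.prod_range_succ, ih, Finset.sum_range_succ, Finset.range_add_one,
      Finset.filter_insert]
    cases hf : f W with
    | none => simp [codeWeight]
    | some d =>
      rw [if_pos (by simp), Finset.card_insert_of_notMem (by simp), pow_succ]
      push_cast
      simp only [codeWeight, Option.getD_some]
      rw [mul_add, neg_add, Real.exp_add]
      push_cast
      ring

theorem exists_alignment_of_editDistance_le {α : Type*} {n m c : ℕ} {x : Fin n → α}
    {y : Fin m → α} (h : editDistance x y ≤ c) : ∃ A, IsAlignment x y A ∧ alignmentCost A ≤ c := by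
  have hne : {c : ℕ | ∃ A : Fin n → Option (Fin m), IsAlignment x y A ∧
      alignmentCost A = c}.Nonempty :=
    ⟨_, fun _ => none, ⟨by simp, by simp⟩, rfl⟩
  obtain ⟨A, hA, hc⟩ := Nat.sInf_mem hne
  exact ⟨A, hA, hc.trans_le h⟩

open Classical in
/-- The number of strings at small edit distance from their trace, for fixed edit operations with
many disjoint windows around isolated errors. -/
theorem card_editDistance_le {α : Type*} [Fintype α] [Nontrivial α] {n : ℕ} (s : ℕ → EditOp)
    (a : ℕ → α) (lo hi : ℕ → ℕ) (h1 : ∀ w, lo w ≤ hi w) (h2 : ∀ w, hi w ≤ lo (w + 1)) (W K C : ℕ)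
    (hW : lo W ≤ n)
    (hK : ∀ w < W, ∀ δ : ℤ, K ≤ ({i ∈ Finset.Ico (lo w) (hi w) |
      ∀ j : ℕ, plantedAlignment s i = some j → (j : ℤ) ≠ i + δ} : Finset ℕ).card)
    {ε : ℝ} (hε : 0 ≤ ε) :
    (Nat.card {x : Fin n → α | editDistance x (indelTrace s a x) ≤ C} : ℝ) ≤
      Fintype.card α ^ n * (Real.exp (ε * C - (W - C)) *
        (1 + ∑ d ∈ Finset.Icc (-C : ℤ) C,
          (1 / 2) ^ K * Real.exp 1 * Real.exp (-(ε * |d|))) ^ W) := by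
  set r : ℝ := (1 / 2) ^ K * Real.exp 1 with hr
  let S : (ℕ → Option ℤ) → Set (Fin n → α) := fun f =>
    {x : Fin n → α | ∃ A, IsAlignment x (indelTrace s a x) A ∧
      ∀ w < W, f w ≠ none → ∀ i : Fin n, lo w ≤ i → (i : ℕ) < hi w →
        ∃ j, A i = some j ∧ (j : ℤ) = i + shiftOf f w}
  -- A single difference is at most the total variation, hence at most `C`. The product set `T`
  -- makes the sum of weights factor; `T'` keeps the constraints that make each weight large enough.
  let T : Finset (Fin W → Option ℤ) :=
    Fintype.piFinset fun _ => Finset.insertNone (Finset.Icc (-C : ℤ) C)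
  let supp : (ℕ → Option ℤ) → ℕ := fun f => ({w ∈ Finset.range W | f w ≠ none} : Finset ℕ).card
  let T' : Finset (Fin W → Option ℤ) := {F ∈ T |
    ∑ k ∈ Finset.range W, |(extendCode F k).getD 0| ≤ (C : ℤ) ∧ W ≤ C + supp (extendCode F)}
  have hcover : ({x : Fin n → α | editDistance x (indelTrace s a x) ≤ C} : Finset (Fin n → α)) ⊆
      T'.biUnion fun F => {x | x ∈ S (extendCode F)} := by
    intro x hx
    obtain ⟨A, hA, hc⟩ := exists_alignment_of_editDistance_le (Finset.mem_filter.1 hx).2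
    obtain ⟨f, hf1, hf2, hf3⟩ := hA.exists_code lo hi h1 h2 W hW
    have hext : ∀ k < W, extendCode (fun k : Fin W => f k) k = f k := by
      intro k hk
      simp [extendCode, hk]
    have hvar : ∑ k ∈ Finset.range W, |(f k).getD 0| ≤ (C : ℤ) :=
      hf2.trans (by exact_mod_cast hc)
    simp only [Finset.mem_biUnion, Finset.mem_filter, Finset.mem_univ, true_and]
    refine ⟨fun k => f k, ?_, A, hA, ?_⟩
    · simp only [T', T, Finset.mem_filter, Fintype.mem_piFinset, supp]
      refine ⟨fun k => ?_, ?_, ?_⟩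
      · rw [Finset.mem_insertNone]
        intro d hd
        have hd' : f k = some d := hd
        have hle := Finset.single_le_sum (f := fun k => |(f k).getD 0|)
          (fun i _ => abs_nonneg _) (Finset.mem_range.2 k.2)
        simp only [hd', Option.getD_some] at hle
        have := abs_le.1 (hle.trans hvar)
        exact Finset.mem_Icc.2 this
      · rw [Finset.sum_congr rfl fun k hk => by rw [hext k (Finset.mem_range.1 hk)]]
        exact hvar
      · rw [Finset.filter_congr fun k hk => by rw [hext k (Finset.mem_range.1 hk)]]
        omega
    · intro w hw hfw i hi1 hi2
      rw [hext w hw] at hfw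
      rw [shiftOf_congr hext hw]
      exact hf1 w hfw i hi1 hi2
  have hα : (2 : ℝ) ≤ Fintype.card α := by
    exact_mod_cast Fintype.one_lt_card (α := α)
  have hone : ∀ F ∈ T', (({x | x ∈ S (extendCode F)} : Finset (Fin n → α)).card : ℝ) ≤
      Fintype.card α ^ n * (Real.exp (ε * C - (W - C)) * ∏ k : Fin W, codeWeight r ε (F k)) := by
    intro F hF
    obtain ⟨-, hF1, hF2⟩ := Finset.mem_filter.1 hF
    have hprod : ∏ k : Fin W, codeWeight r ε (F k) =
        ∏ k ∈ Finset.range W, codeWeight r ε (extendCode F k) := by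
      rw [Finset.prod_range]
      exact Finset.prod_congr rfl fun k _ => by simp [extendCode]
    have hcnt := card_code_mul_le s a lo hi h1 h2 W K hW hK (extendCode F)
    have hcnt' : (({x | x ∈ S (extendCode F)} : Finset (Fin n → α)).card : ℝ) *
        (Fintype.card α : ℝ) ^ (K * supp (extendCode F)) ≤ (Fintype.card α : ℝ) ^ n := by
      rw [Nat.card_eq_fintype_card, Fintype.card_ofFinset] at hcnt
      exact_mod_cast hcnt
    have hpow : (1 : ℝ) ≤ (Fintype.card α : ℝ) ^ (K * supp (extendCode F)) *
        ((1 / 2) ^ K) ^ supp (extendCode F) := by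
      rw [← pow_mul, ← mul_pow]
      exact one_le_pow₀ (by linarith)
    rw [hprod, prod_codeWeight, hr, mul_pow, ← Real.exp_nat_mul]
    -- Both constraints defining `T'` enter: the variation is at most `C`, and at least `W - C`
    -- windows are intact.
    have hexp : (1 : ℝ) ≤ Real.exp (ε * C - (W - C)) *
        (Real.exp ((supp (extendCode F) : ℕ) * 1) *
        Real.exp (-(ε * (∑ k ∈ Finset.range W, |(extendCode F k).getD 0| : ℤ)))) := by
      rw [← Real.exp_add, ← Real.exp_add]
      apply Real.one_le_exp
      have e1 : ((∑ k ∈ Finset.range W, |(extendCode F k).getD 0| : ℤ) : ℝ) ≤ C := by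
        exact_mod_cast hF1
      have e2 : (W : ℝ) ≤ C + supp (extendCode F) := by exact_mod_cast hF2
      have e3 := mul_le_mul_of_nonneg_left e1 hε
      linarith
    have hcard0 : (0 : ℝ) ≤ ({x | x ∈ S (extendCode F)} : Finset (Fin n → α)).card := by positivity
    calc (({x | x ∈ S (extendCode F)} : Finset (Fin n → α)).card : ℝ)
        ≤ ({x | x ∈ S (extendCode F)} : Finset (Fin n → α)).card *
          ((Fintype.card α : ℝ) ^ (K * supp (extendCode F)) *
            ((1 / 2) ^ K) ^ supp (extendCode F)) := le_mul_of_one_le_right hcard0 hpow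
      _ = (({x | x ∈ S (extendCode F)} : Finset (Fin n → α)).card *
          (Fintype.card α : ℝ) ^ (K * supp (extendCode F))) *
            ((1 / 2) ^ K) ^ supp (extendCode F) := by ring
      _ ≤ (Fintype.card α : ℝ) ^ n * ((1 / 2) ^ K) ^ supp (extendCode F) := by gcongr
      _ ≤ (Fintype.card α : ℝ) ^ n * ((1 / 2) ^ K) ^ supp (extendCode F) *
          (Real.exp (ε * C - (W - C)) * (Real.exp ((supp (extendCode F) : ℕ) * 1) *
          Real.exp (-(ε * (∑ k ∈ Finset.range W, |(extendCode F k).getD 0| : ℤ))))) :=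
        le_mul_of_one_le_right (by positivity) hexp
      _ = _ := by ring
  have hsum : ∑ F ∈ T, ∏ k : Fin W, codeWeight r ε (F k) =
      (1 + ∑ d ∈ Finset.Icc (-C : ℤ) C, r * Real.exp (-(ε * |d|))) ^ W := by
    rw [← Finset.prod_univ_sum, Finset.prod_congr rfl fun k _ => Finset.sum_insertNone _ _]
    simp [codeWeight]
  have hnn : ∀ o, 0 ≤ codeWeight r ε o := by
    intro o
    cases o with
    | none => simp [codeWeight]
    | some d => simp only [codeWeight]; positivity
  rw [Nat.card_eq_fintype_card, Fintype.card_ofFinset]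
  calc ((Finset.card {x : Fin n → α | editDistance x (indelTrace s a x) ≤ C} : ℕ) : ℝ)
      ≤ ∑ F ∈ T', (({x | x ∈ S (extendCode F)} : Finset (Fin n → α)).card : ℝ) := by
        exact_mod_cast (Finset.card_le_card hcover).trans Finset.card_biUnion_le
    _ ≤ ∑ F ∈ T', Fintype.card α ^ n *
          (Real.exp (ε * C - (W - C)) * ∏ k : Fin W, codeWeight r ε (F k)) :=
        Finset.sum_le_sum hone
    _ ≤ ∑ F ∈ T, Fintype.card α ^ n *
          (Real.exp (ε * C - (W - C)) * ∏ k : Fin W, codeWeight r ε (F k)) := by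
        apply Finset.sum_le_sum_of_subset_of_nonneg (Finset.filter_subset _ _)
        intro F _ _
        have := Finset.prod_nonneg fun k (_ : k ∈ Finset.univ) => hnn (F k)
        positivity
    _ = _ := by rw [← Finset.mul_sum, ← Finset.mul_sum, hsum]

/-! ### Isolated, crowded and recent times -/

/-- The number of consecutive `keep` steps immediately before time `t`. -/
def keepRun (s : ℕ → EditOp) : ℕ → ℕ
  | 0 => 0
  | t + 1 =>
    match s t with
    | EditOp.keep => keepRun s t + 1
    | _ => 0

theorem keepRun_succ_keep {s : ℕ → EditOp} {t : ℕ} (h : s t = EditOp.keep) :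
    keepRun s (t + 1) = keepRun s t + 1 := by
  rw [keepRun, h]

theorem keepRun_succ_ne {s : ℕ → EditOp} {t : ℕ} (h : s t ≠ EditOp.keep) :
    keepRun s (t + 1) = 0 := by
  rw [keepRun]
  split
  · exact absurd ‹_› h
  · rfl

theorem keepRun_le (s : ℕ → EditOp) (t : ℕ) : keepRun s t ≤ t := by
  induction t with
  | zero => simp [keepRun]
  | succ t ih =>
    by_cases h : s t = EditOp.keep
    · rw [keepRun_succ_keep h]; omega
    · rw [keepRun_succ_ne h]; omega

theorem eq_keep_of_le_keepRun {s : ℕ → EditOp} {t t' : ℕ} (h : t' < t)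
    (h' : t ≤ t' + keepRun s t) : s t' = EditOp.keep := by
  induction t with
  | zero => omega
  | succ t ih =>
    by_cases hk : s t = EditOp.keep
    · rw [keepRun_succ_keep hk] at h'
      rcases (Nat.lt_succ_iff.1 h).lt_or_eq with h1 | rfl
      · exact ih h1 (by omega)
      · exact hk
    · rw [keepRun_succ_ne hk] at h'
      omega

section Counts

open Classical in
/-- The number of insertions and deletions before time `n`. -/
noncomputable def errorCount (s : ℕ → EditOp) (n : ℕ) : ℕ :=
  ({t ∈ Finset.range n | s t ≠ EditOp.keep} : Finset ℕ).card

open Classical in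
/-- The number of errors before time `n` that are preceded by fewer than `l` keeps. -/
noncomputable def crowdedCount (l : ℕ) (s : ℕ → EditOp) (n : ℕ) : ℕ :=
  ({t ∈ Finset.range n | s t ≠ EditOp.keep ∧ keepRun s t < l} : Finset ℕ).card

/-- The number of times before `n` that are preceded by fewer than `l` keeps. -/
def recentCount (l : ℕ) (s : ℕ → EditOp) (n : ℕ) : ℕ :=
  ({t ∈ Finset.range n | keepRun s t < l} : Finset ℕ).card

open Classical in
/-- The errors before time `n` that have no other error within distance `l`. -/
noncomputable def isolatedErrors (l : ℕ) (s : ℕ → EditOp) (n : ℕ) : Finset ℕ :=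
  {t ∈ Finset.range n | s t ≠ EditOp.keep ∧ l ≤ keepRun s t ∧
    ∀ t' < n, t < t' → t' ≤ t + l → s t' = EditOp.keep}

theorem mem_isolatedErrors {l n t : ℕ} {s : ℕ → EditOp} :
    t ∈ isolatedErrors l s n ↔ t < n ∧ s t ≠ EditOp.keep ∧ l ≤ keepRun s t ∧
      ∀ t' < n, t < t' → t' ≤ t + l → s t' = EditOp.keep := by
  simp [isolatedErrors]

theorem errorCount_succ (s : ℕ → EditOp) (n : ℕ) [Decidable (s n ≠ EditOp.keep)] :
    errorCount s (n + 1) = errorCount s n + if s n ≠ EditOp.keep then 1 else 0 := by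
  classical
  unfold errorCount
  rw [Finset.range_add_one, Finset.filter_insert]
  by_cases h : s n = EditOp.keep
  · simp [h]
  · rw [if_pos h, if_pos h, Finset.card_insert_of_notMem (by simp)]

theorem crowdedCount_succ (l : ℕ) (s : ℕ → EditOp) (n : ℕ)
    [Decidable (s n ≠ EditOp.keep ∧ keepRun s n < l)] :
    crowdedCount l s (n + 1) =
      crowdedCount l s n + if s n ≠ EditOp.keep ∧ keepRun s n < l then 1 else 0 := by
  classical
  unfold crowdedCount
  rw [Finset.range_add_one, Finset.filter_insert]
  by_cases h : s n ≠ EditOp.keep ∧ keepRun s n < l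
  · rw [if_pos h, if_pos h, Finset.card_insert_of_notMem (by simp)]
  · rw [if_neg h, if_neg h, add_zero]

theorem recentCount_succ (l : ℕ) (s : ℕ → EditOp) (n : ℕ) :
    recentCount l s (n + 1) = recentCount l s n + if keepRun s n < l then 1 else 0 := by
  unfold recentCount
  rw [Finset.range_add_one, Finset.filter_insert]
  split_ifs
  · rw [Finset.card_insert_of_notMem (by simp)]
  · rfl

/-- Each error makes at most `l` later times recent, and the start of the process acts as one more
error because `keepRun` begins at 0. -/
theorem recentCount_le (l : ℕ) (s : ℕ → EditOp) (n : ℕ) :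
    recentCount l s n ≤ l * (errorCount s n + 1) := by
  classical
  suffices h : recentCount l s n ≤ l * errorCount s n + min (keepRun s n) l by
    rw [mul_add, mul_one]
    omega
  induction n with
  | zero => simp [recentCount]
  | succ n ih =>
    rw [recentCount_succ, errorCount_succ]
    by_cases h : s n = EditOp.keep
    · rw [keepRun_succ_keep h, if_neg (not_not.2 h), add_zero]
      split_ifs <;> omega
    · rw [keepRun_succ_ne h, if_pos h, mul_add, mul_one]
      split_ifs <;> omega

/-- Two isolated errors among the last `l` times would be within distance `l` of each other. -/
theorem card_isolatedErrors_le (l : ℕ) (s : ℕ → EditOp) (n : ℕ) :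
    (isolatedErrors l s n).card ≤
      ({t ∈ isolatedErrors l s n | t + l < n} : Finset ℕ).card + 1 := by
  rw [← Finset.card_filter_add_card_filter_not (s := isolatedErrors l s n) (fun t => t + l < n)]
  apply Nat.add_le_add_left
  rw [Finset.card_le_one]
  intro t ht t' ht'
  obtain ⟨ht1, ht2⟩ := Finset.mem_filter.1 ht
  obtain ⟨ht1', ht2'⟩ := Finset.mem_filter.1 ht'
  obtain ⟨e1, e2, -, e3⟩ := mem_isolatedErrors.1 ht1
  obtain ⟨e1', e2', -, e3'⟩ := mem_isolatedErrors.1 ht1'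
  rcases lt_trichotomy t t' with h | h | h
  · exact absurd (e3 t' e1' h (by omega)) e2'
  · exact h
  · exact absurd (e3' t e1 h (by omega)) e2

/-- A crowded error spoils at most itself and one earlier isolated error, which explains the factor
2. -/
theorem errorCount_le_isolated (l : ℕ) (s : ℕ → EditOp) (n : ℕ) :
    errorCount s n ≤ (isolatedErrors l s n).card + 2 * crowdedCount l s n := by
  classical
  induction n with
  | zero => simp [errorCount]
  | succ n ih =>
    rw [errorCount_succ, crowdedCount_succ]
    by_cases h : s n = EditOp.keep
    · have : isolatedErrors l s n ⊆ isolatedErrors l s (n + 1) := by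
        intro t ht
        obtain ⟨e1, e2, e3, e4⟩ := mem_isolatedErrors.1 ht
        refine mem_isolatedErrors.2 ⟨by omega, e2, e3, fun t' ht' h1 h2 => ?_⟩
        rcases (Nat.lt_succ_iff.1 ht').lt_or_eq with h3 | rfl
        · exact e4 t' h3 h1 h2
        · exact h
      have := Finset.card_le_card this
      rw [if_neg (not_not.2 h), if_neg (fun h' => h'.1 h)]
      omega
    · rw [if_pos h]
      by_cases hr : keepRun s n < l
      · have : ({t ∈ isolatedErrors l s n | t + l < n} : Finset ℕ) ⊆
            isolatedErrors l s (n + 1) := by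
          intro t ht
          obtain ⟨ht, htl⟩ := Finset.mem_filter.1 ht
          obtain ⟨e1, e2, e3, e4⟩ := mem_isolatedErrors.1 ht
          refine mem_isolatedErrors.2 ⟨by omega, e2, e3, fun t' ht' h1 h2 => ?_⟩
          exact e4 t' (by omega) h1 h2
        have := Finset.card_le_card this
        have := card_isolatedErrors_le l s n
        rw [if_pos ⟨h, hr⟩]
        omega
      · have : insert n (isolatedErrors l s n) ⊆ isolatedErrors l s (n + 1) := by
          intro t ht
          rcases Finset.mem_insert.1 ht with rfl | ht
          · exact mem_isolatedErrors.2 ⟨by omega, h, by omega, fun t' _ _ _ => by omega⟩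
          · obtain ⟨e1, e2, e3, e4⟩ := mem_isolatedErrors.1 ht
            refine mem_isolatedErrors.2 ⟨by omega, e2, e3, fun t' ht' h1 h2 => ?_⟩
            rcases (Nat.lt_succ_iff.1 ht').lt_or_eq with h3 | rfl
            · exact e4 t' h3 h1 h2
            · exact absurd (eq_keep_of_le_keepRun e1 (by omega)) e2
        have := Finset.card_le_card this
        rw [Finset.card_insert_of_notMem fun hn =>
          absurd (mem_isolatedErrors.1 hn).1 (lt_irrefl _)] at this
        rw [if_neg (fun h' => hr h'.2)]
        omega

end Counts

open Classical in
/-- Isolated errors give disjoint windows on which every shift violates the planted alignment in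
many places. -/
theorem exists_windows (s : ℕ → EditOp) (n K W : ℕ)
    (hW : W + 1 ≤ (isolatedErrors (2 * K) s n).card) :
    ∃ lo hi : ℕ → ℕ, (∀ w, lo w ≤ hi w) ∧ (∀ w, hi w ≤ lo (w + 1)) ∧ lo W ≤ n ∧
      ∀ w < W, ∀ δ : ℤ, K ≤ ({i ∈ Finset.Ico (lo w) (hi w) |
        ∀ j : ℕ, plantedAlignment s i = some j → (j : ℤ) ≠ i + δ} : Finset ℕ).card := by
  set I : Finset ℕ := {t ∈ isolatedErrors (2 * K) s n | t + 2 * K < n} with hI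
  have hWI : W ≤ I.card := by
    have hc : (isolatedErrors (2 * K) s n).card ≤ I.card + 1 := by
      rw [hI]
      convert card_isolatedErrors_le (2 * K) s n
    omega
  let e := I.orderEmbOfFin rfl
  let T : ℕ → ℕ := fun w => if h : w < W then e ⟨w, h.trans_le hWI⟩ else 0
  have hTmem : ∀ w < W, T w ∈ I := by
    intro w hw
    simp only [T, dif_pos hw]
    exact I.orderEmbOfFin_mem rfl _
  have hTlt : ∀ w, w + 1 < W → T w < T (w + 1) := by
    intro w hw
    simp only [T, dif_pos hw, dif_pos (show w < W by omega)]
    exact e.strictMono (Fin.mk_lt_mk.2 (Nat.lt_succ_self w))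
  have hT : ∀ w < W, T w + 2 * K < n ∧ s (T w) ≠ EditOp.keep ∧ 2 * K ≤ keepRun s (T w) ∧
      ∀ t' < n, T w < t' → t' ≤ T w + 2 * K → s t' = EditOp.keep := by
    intro w hw
    obtain ⟨h1, h2⟩ := Finset.mem_filter.1 (hTmem w hw)
    obtain ⟨-, h3, h4, h5⟩ := mem_isolatedErrors.1 h1
    exact ⟨h2, h3, h4, h5⟩
  -- Each window reaches `K` steps to either side of its error. Isolation at distance `2 * K` keeps
  -- consecutive windows disjoint; discarding a possible error in the last `2 * K` steps keeps them
  -- inside the string.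
  refine ⟨fun w => if w < W then (pointers s (T w - K)).1 else n,
    fun w => if w < W then (pointers s (T w + K + 1)).1 else n, fun w => ?_, fun w => ?_, ?_, ?_⟩
  · dsimp only
    split_ifs with hw
    · exact pointers_fst_mono s (by omega)
    · exact le_rfl
  · dsimp only
    by_cases hw : w < W
    · rw [if_pos hw]
      have h1 := hT w hw
      split_ifs with hw'
      · apply pointers_fst_mono s
        have h2 := hT (w + 1) hw'
        have h3 := hTlt w hw'
        have h4 : ¬ (T (w + 1) ≤ T w + 2 * K) := fun hle => h2.2.1 (h1.2.2.2 _ (by omega) h3 hle)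
        omega
      · refine (pointers_fst_le s _).trans ?_
        by_cases hK0 : K = 0
        · omega
        · omega
    · rw [if_neg hw, if_neg (by omega)]
  · simp
  · intro w hw δ
    obtain ⟨h1, h2, h3, h4⟩ := hT w hw
    have h5 := keepRun_le s (T w)
    obtain ⟨b, hb⟩ := Nat.exists_eq_add_of_le' (show K ≤ T w by omega)
    simp only [if_pos hw, hb, Nat.add_sub_cancel]
    rw [show b + K + K + 1 = b + K + 1 + K by ring]
    rw [hb] at h1 h2 h3 h4 h5
    refine le_card_planted_ne h2 (fun r hr => ?_) (fun r hr => ?_) δ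
    · exact eq_keep_of_le_keepRun (t := b + K) (by omega) (by omega)
    · exact h4 _ (by omega) (by omega) (by omega)

/-! ### An exponential supermartingale for the edit operations -/

instance : Finite EditOp :=
  Finite.of_surjective
    (fun i : Fin 3 => if i = 0 then EditOp.keep else if i = 1 then EditOp.delete else EditOp.insert)
    fun e => by
      cases e
      · exact ⟨0, rfl⟩
      · exact ⟨1, rfl⟩
      · exact ⟨2, rfl⟩

instance : DiscreteMeasurableSpace EditOp := ⟨fun _ => trivial⟩

theorem DependsOn.exists_comp_restrict {E β : Type*} [Nonempty β] {n : ℕ} {X : (ℕ → E) → β}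
    (hX : DependsOn X (Finset.range n : Set ℕ)) :
    ∃ Z : ((i : Finset.range n) → E) → β, X = fun s => Z fun i => s i := by
  obtain ⟨Z, hZ⟩ := dependsOn_iff_exists_comp.1 hX
  exact ⟨Z, hZ⟩

theorem DependsOn.measurable_range {E β : Type*} [MeasurableSpace E] [DiscreteMeasurableSpace E]
    [Finite E] [Nonempty β] [MeasurableSpace β] {n : ℕ} {X : (ℕ → E) → β}
    (hX : DependsOn X (Finset.range n : Set ℕ)) : Measurable X := by
  obtain ⟨Z, rfl⟩ := hX.exists_comp_restrict
  exact (measurable_of_finite Z).comp (by fun_prop)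

theorem DependsOn.integrable_range {E : Type*} [MeasurableSpace E] [DiscreteMeasurableSpace E]
    [Finite E] {n : ℕ} {X : (ℕ → E) → ℝ} (hX : DependsOn X (Finset.range n : Set ℕ))
    (μ : Measure (ℕ → E)) [IsFiniteMeasure μ] : Integrable X μ := by
  obtain ⟨Z, rfl⟩ := hX.exists_comp_restrict
  have hm : Measurable fun (s : ℕ → E) (i : Finset.range n) => s i := by fun_prop
  have hZ : Integrable Z (μ.map fun (s : ℕ → E) (i : Finset.range n) => s i) :=
    Integrable.of_finite
  exact hZ.comp_measurable hm

/-- The law of the whole sequence of edit operations. -/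
noncomputable abbrev editOpsLaw (p : unitInterval) : Measure (ℕ → EditOp) :=
  Measure.infinitePi fun _ : ℕ => editOpLaw p

open Classical in
theorem integral_error (p : unitInterval) (n : ℕ) :
    ∫ s, (if s n = EditOp.keep then (0 : ℝ) else 1) ∂(editOpsLaw p) = p := by
  have h := (measurePreserving_eval_infinitePi (fun _ : ℕ => editOpLaw p) n)
  have h2 := integral_map (μ := editOpsLaw p) (φ := fun s : ℕ → EditOp => s n)
    (f := fun e : EditOp => if e = EditOp.keep then (0 : ℝ) else 1)
    (measurable_pi_apply n).aemeasurable (measurable_of_finite _).aestronglyMeasurable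
  rw [← h2, show Measure.map (fun s : ℕ → EditOp => s n) (editOpsLaw p) = editOpLaw p from h.map_eq,
    editOpLaw, integral_add_measure, integral_add_measure, integral_smul_measure,
    integral_smul_measure, integral_smul_measure, integral_dirac, integral_dirac, integral_dirac]
  · have : (0 : ℝ) ≤ p := p.2.1
    simp only [reduceCtorEq, if_true, if_false, smul_eq_mul, mul_zero, mul_one, zero_add]
    rw [ENNReal.toReal_ofReal (by linarith)]
    ring
  · exact Integrable.of_finite.smul_measure ENNReal.ofReal_ne_top
  · exact Integrable.of_finite.smul_measure ENNReal.ofReal_ne_top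
  · exact (Integrable.of_finite.smul_measure ENNReal.ofReal_ne_top).add_measure
      (Integrable.of_finite.smul_measure ENNReal.ofReal_ne_top)
  · exact Integrable.of_finite.smul_measure ENNReal.ofReal_ne_top

open Classical in
theorem integral_mul_error (p : unitInterval) (n : ℕ) {X : (ℕ → EditOp) → ℝ}
    (hX : DependsOn X (Finset.range n : Set ℕ)) :
    ∫ s, X s * (if s n = EditOp.keep then (0 : ℝ) else 1) ∂(editOpsLaw p)
      = (∫ s, X s ∂(editOpsLaw p)) * p := by
  have hi : iIndepFun (fun (i : ℕ) (s : ℕ → EditOp) => s i) (editOpsLaw p) :=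
    iIndepFun_infinitePi (X := fun _ e => e) fun _ => measurable_id
  have hi2 := hi.indepFun_finset (Finset.range n) {n} (by simp) fun i => measurable_pi_apply i
  obtain ⟨Z, hZ⟩ := hX.exists_comp_restrict
  have hi3 := hi2.comp (φ := Z)
    (ψ := fun e => if e ⟨n, by simp⟩ = EditOp.keep then (0 : ℝ) else 1)
    (measurable_of_finite _) (measurable_of_finite _)
  have := hi3.integral_fun_mul_eq_mul_integral
    ((measurable_of_finite Z).comp (by fun_prop)).aestronglyMeasurable
    ((measurable_of_finite _).comp (by fun_prop)).aestronglyMeasurable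
  rw [← integral_error p n, hZ]
  exact this

open Classical in
/-- The logarithm of an exponential supermartingale attached to the edit operations. -/
noncomputable def errorPotential (p : unitInterval) (g : ℕ → ℝ) (s : ℕ → EditOp) (n : ℕ) : ℝ :=
  ∑ t ∈ Finset.range n, ((if s t = EditOp.keep then 0 else g (keepRun s t))
    - p * (Real.exp (g (keepRun s t)) - 1))

theorem dependsOn_keepRun (n : ℕ) :
    DependsOn (fun s : ℕ → EditOp => keepRun s n) (Finset.range n : Set ℕ) := by
  intro s s' h
  induction n with
  | zero => rfl
  | succ n ih =>
    have e1 := ih fun i hi => h i (by simp at hi ⊢; omega)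
    have e2 := h n (by simp)
    simp only at e1 ⊢
    rw [keepRun, keepRun, e1, e2]

theorem dependsOn_errorPotential (p : unitInterval) (g : ℕ → ℝ) (n : ℕ) :
    DependsOn (fun s : ℕ → EditOp => errorPotential p g s n) (Finset.range n : Set ℕ) := by
  classical
  intro s s' h
  refine Finset.sum_congr rfl fun t ht => ?_
  have e1 := dependsOn_keepRun t (x := s) (y := s')
    fun i hi => h i (by simp at hi ht ⊢; omega)
  simp only at e1
  rw [e1, h t ht]

/-- `keepRun s n` is determined by the past and step `n` is independent of it, so the conditional
exponential moment is `1 + p * (exp g - 1)`. The compensator dominates it through `1 + x ≤ exp x`.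
-/
theorem integral_exp_errorPotential_le (p : unitInterval) (g : ℕ → ℝ) (n : ℕ) :
    ∫ s, Real.exp (errorPotential p g s n) ∂(editOpsLaw p) ≤ 1 := by
  classical
  induction n with
  | zero => simp [errorPotential]
  | succ n ih =>
    let U : (ℕ → EditOp) → ℝ := fun s => Real.exp (errorPotential p g s n) *
      Real.exp (-(p * (Real.exp (g (keepRun s n)) - 1)))
    let V : (ℕ → EditOp) → ℝ := fun s => U s * (Real.exp (g (keepRun s n)) - 1)
    have hU : DependsOn U (Finset.range n : Set ℕ) := by
      intro s s' h
      have e1 := dependsOn_keepRun n h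
      have e2 := dependsOn_errorPotential p g n h
      simp only at e1 e2
      simp only [U, e1, e2]
    have hV : DependsOn V (Finset.range n : Set ℕ) := by
      intro s s' h
      have e1 := dependsOn_keepRun n h
      simp only at e1
      simp only [V, e1, hU h]
    have hP : DependsOn (fun s => Real.exp (errorPotential p g s n))
        (Finset.range n : Set ℕ) := by
      intro s s' h
      exact congrArg Real.exp (dependsOn_errorPotential p g n h)
    have hVE : DependsOn (fun s => V s * (if s n = EditOp.keep then (0 : ℝ) else 1))
        (Finset.range (n + 1) : Set ℕ) := by
      intro s s' h
      simp only
      rw [hV fun i hi => h i (by simp at hi ⊢; omega), h n (by simp)]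
    have hsplit : ∀ s, Real.exp (errorPotential p g s (n + 1)) =
        U s + V s * (if s n = EditOp.keep then (0 : ℝ) else 1) := by
      intro s
      rw [errorPotential, Finset.sum_range_succ, ← errorPotential, Real.exp_add, sub_eq_add_neg,
        Real.exp_add]
      by_cases h : s n = EditOp.keep
      · simp [h, U]
      · simp only [h, if_false, V, U]
        ring
    simp_rw [hsplit]
    rw [integral_add (hU.integrable_range _) (hVE.integrable_range _), integral_mul_error p n hV,
      ← integral_mul_const, ← integral_add (hU.integrable_range _)
        ((hV.integrable_range _).mul_const _)]
    refine le_trans (integral_mono ((hU.integrable_range _).add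
      ((hV.integrable_range _).mul_const _)) (hP.integrable_range _) fun s => ?_) ih
    simp only [V, U]
    have h1 := Real.add_one_le_exp (p * (Real.exp (g (keepRun s n)) - 1) : ℝ)
    rw [Real.exp_neg]
    have h2 := Real.exp_pos (p * (Real.exp (g (keepRun s n)) - 1) : ℝ)
    have h3 := Real.exp_pos (errorPotential p g s n)
    calc _ = Real.exp (errorPotential p g s n) *
          ((p * (Real.exp (g (keepRun s n)) - 1) + 1) *
          (Real.exp (p * (Real.exp (g (keepRun s n)) - 1)))⁻¹) := by ring
      _ ≤ Real.exp (errorPotential p g s n) * 1 := by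
        gcongr
        rw [← div_eq_mul_inv]
        exact (div_le_one h2).2 h1
      _ = _ := mul_one _

theorem measureReal_errorPotential_ge_le (p : unitInterval) (g : ℕ → ℝ) (n : ℕ) (τ : ℝ) :
    (editOpsLaw p).real {s | τ ≤ errorPotential p g s n} ≤ Real.exp (-τ) := by
  have hP : DependsOn (fun s => Real.exp (errorPotential p g s n))
      (Finset.range n : Set ℕ) := by
    intro s s' h
    exact congrArg Real.exp (dependsOn_errorPotential p g n h)
  have h := mul_meas_ge_le_integral_of_nonneg (μ := editOpsLaw p)
    (Filter.Eventually.of_forall fun s => (Real.exp_pos (errorPotential p g s n)).le)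
    (hP.integrable_range _) (Real.exp τ)
  simp only [Real.exp_le_exp] at h
  rw [Real.exp_neg, ← one_div, le_div_iff₀ (Real.exp_pos τ), mul_comm]
  exact h.trans (integral_exp_errorPotential_le p g n)

theorem Real.exp_neg_le_quadratic {x : ℝ} (hx : 0 ≤ x) : Real.exp (-x) ≤ 1 - x + x ^ 2 / 2 := by
  have h := Real.quadratic_le_exp_of_nonneg hx
  rw [Real.exp_neg, inv_le_comm₀ (Real.exp_pos x) (by nlinarith [sq_nonneg (x - 1)])]
  refine le_trans ?_ h
  rw [inv_le_iff_one_le_mul₀ (by nlinarith [sq_nonneg (x - 1)])]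
  nlinarith [sq_nonneg (x ^ 2)]

/-- Lower tail of the number of errors. -/
theorem measureReal_errorCount_le (p : unitInterval) (n : ℕ) {ε : ℝ} (hε : 0 ≤ ε) :
    (editOpsLaw p).real {s | (errorCount s n : ℝ) ≤ (1 - ε) * (p * n)} ≤
      Real.exp (-(ε ^ 2 * (p * n) / 2)) := by
  classical
  refine le_trans (measureReal_mono fun s hs => ?_)
    (measureReal_errorPotential_ge_le p (fun _ => -ε) n (ε ^ 2 * (p * n) / 2))
  have hs' : (errorCount s n : ℝ) ≤ (1 - ε) * (p * n) := hs
  have he : errorPotential p (fun _ => -ε) s n =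
      -ε * errorCount s n - n * (p * (Real.exp (-ε) - 1)) := by
    rw [errorPotential, Finset.sum_sub_distrib, errorCount, Finset.card_filter]
    push_cast
    rw [Finset.mul_sum]
    congr 1
    · refine Finset.sum_congr rfl fun t _ => ?_
      by_cases h : s t = EditOp.keep <;> simp [h]
    · simp
  rw [Set.mem_ofPred_eq, he]
  have h1 := Real.exp_neg_le_quadratic hε
  have h2 : (0 : ℝ) ≤ p * n := mul_nonneg p.2.1 n.cast_nonneg
  have h3 := mul_le_mul_of_nonneg_left hs' hε
  have h4 := mul_le_mul_of_nonneg_left h1 h2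
  nlinarith

/-- Upper tail of the number of crowded errors. -/
theorem measureReal_crowdedCount_ge (p : unitInterval) (n l : ℕ) (τ : ℝ) :
    (editOpsLaw p).real
      {s | (Real.exp 1 - 1) * p * recentCount l s n + τ ≤ crowdedCount l s n} ≤
      Real.exp (-τ) := by
  classical
  refine le_trans (measureReal_mono fun s hs => ?_)
    -- Taking `g` to be the indicator of a recent error makes the potential count crowded errors,
    -- with compensator `(e - 1) * p` per recent time.
    (measureReal_errorPotential_ge_le p (fun c => if c < l then 1 else 0) n τ)
  have hs' : (Real.exp 1 - 1) * p * recentCount l s n + τ ≤ crowdedCount l s n := hs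
  have he : errorPotential p (fun c => if c < l then 1 else 0) s n =
      crowdedCount l s n - (Real.exp 1 - 1) * p * recentCount l s n := by
    rw [errorPotential, Finset.sum_sub_distrib, crowdedCount, recentCount, Finset.card_filter,
      Finset.card_filter]
    push_cast
    rw [Finset.mul_sum]
    congr 1
    · refine Finset.sum_congr rfl fun t _ => ?_
      by_cases h : s t = EditOp.keep <;> simp [h]
    · refine Finset.sum_congr rfl fun t _ => ?_
      split_ifs
      · ring
      · simp
  rw [Set.mem_ofPred_eq, he]
  linarith

/-! ### Numerical estimates for fixed edit operations -/

theorem sum_exp_neg_abs_le {ε : ℝ} (h0 : 0 < ε) (h1 : ε ≤ 1) (C : ℕ) :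
    ∑ d ∈ Finset.Icc (-C : ℤ) C, Real.exp (-(ε * |d|)) ≤ 4 / ε := by
  classical
  have hgeo : ∑ k ∈ Finset.range (C + 1), Real.exp (-(ε * k)) ≤ 2 / ε := by
    have hx : 1 - Real.exp (-ε) ≥ ε / 2 := by
      have := Real.exp_neg_le_quadratic h0.le
      nlinarith
    have hs := mul_neg_geom_sum (Real.exp (-ε)) (C + 1)
    have heq : ∑ k ∈ Finset.range (C + 1), Real.exp (-(ε * k)) =
        ∑ k ∈ Finset.range (C + 1), Real.exp (-ε) ^ k := by
      refine Finset.sum_congr rfl fun k _ => ?_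
      rw [← Real.exp_nat_mul]
      congr 1
      ring
    rw [heq, le_div_iff₀ h0]
    have hpos : 0 ≤ Real.exp (-ε) ^ (C + 1) := by positivity
    have hnn : 0 ≤ ∑ k ∈ Finset.range (C + 1), Real.exp (-ε) ^ k := by positivity
    nlinarith
  have hsub : Finset.Icc (-C : ℤ) C ⊆ (Finset.range (C + 1)).image (fun k : ℕ => (k : ℤ)) ∪
      (Finset.range (C + 1)).image (fun k : ℕ => -(k : ℤ)) := by
    intro d hd
    obtain ⟨e1, e2⟩ := Finset.mem_Icc.1 hd
    simp only [Finset.mem_union, Finset.mem_image, Finset.mem_range]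
    rcases le_total 0 d with h | h
    · exact Or.inl ⟨d.toNat, by omega, by omega⟩
    · exact Or.inr ⟨(-d).toNat, by omega, by omega⟩
  have hnn : ∀ d : ℤ, 0 ≤ Real.exp (-(ε * |d|)) := fun d => (Real.exp_pos _).le
  refine (Finset.sum_le_sum_of_subset_of_nonneg hsub fun d _ _ => hnn d).trans ?_
  refine (le_trans (le_add_of_nonneg_right (Finset.sum_nonneg fun d _ => hnn d))
    (Finset.sum_union_inter).le).trans ?_
  rw [Finset.sum_image (by intro a _ b _ h; simpa using h),
    Finset.sum_image (by intro a _ b _ h; simpa using h)]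
  have e : ∀ k : ℕ, |(k : ℤ)| = k := fun k => abs_of_nonneg (by positivity)
  simp only [abs_neg, e, Int.cast_natCast]
  calc _ ≤ 2 / ε + 2 / ε := add_le_add hgeo hgeo
    _ = 4 / ε := by ring

/-- Admissible error rates are tiny; the quantity `K` is the half-width of the windows. -/
theorem exists_window_size {p ε : ℝ} (hp : 0 < p) (hpε : p ≤ ε)
    (hε : 15 * p * Real.logb 2 (1 / p) ≤ ε) (hε' : ε ≤ 1 / 6) :
    p ≤ 1 / 512 ∧ 135 * p ≤ ε ∧
      ∃ K : ℕ, 135 * (K * p) ≤ 19 * ε ∧ ((1 : ℝ) / 2) ^ K ≤ p ^ 2 := by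
  set L := Real.logb 2 (1 / p) with hL
  have hlog : ∀ k : ℕ, p ≤ 1 / 2 ^ k → (k : ℝ) ≤ L := by
    intro k hk
    rw [hL, Real.le_logb_iff_rpow_le one_lt_two (by positivity), Real.rpow_natCast]
    rw [le_div_iff₀ (by positivity)] at hk ⊢
    linarith
  have hmul : ∀ k : ℕ, p ≤ 1 / 2 ^ k → 15 * (k * p) ≤ ε := by
    intro k hk
    have := mul_le_mul_of_nonneg_left (hlog k hk) hp.le
    linarith
  -- Bootstrap: each lower bound on `L` improves the upper bound on `p`, from `1/4` to `1/128` to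
  -- `1/512`, where `L ≥ 9`.
  have a1 := hmul 2 (by norm_num; linarith)
  have a2 := hmul 7 (by norm_num at a1 ⊢; linarith)
  have hk9 : p ≤ 1 / 2 ^ 9 := by norm_num at a2 ⊢; linarith
  have a3 := hmul 9 hk9
  have h9 := hlog 9 hk9
  norm_num at a3 h9 hk9
  refine ⟨by norm_num; exact hk9, by linarith, ⌈2 * L⌉₊, ?_, ?_⟩
  -- Rounding up adds at most 1, and `1 ≤ L / 9`.
  · have h1 : (⌈2 * L⌉₊ : ℝ) ≤ 19 / 9 * L := by
      have := Nat.ceil_lt_add_one (show 0 ≤ 2 * L by linarith)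
      linarith
    have h2 := mul_le_mul_of_nonneg_right h1 hp.le
    linarith
  · have h1 : 2 * L ≤ (⌈2 * L⌉₊ : ℝ) := Nat.le_ceil _
    have h2 : (2 : ℝ) ^ (2 * L) ≤ 2 ^ (⌈2 * L⌉₊ : ℝ) :=
      Real.rpow_le_rpow_of_exponent_le one_le_two h1
    have h3 : (2 : ℝ) ^ L = 1 / p :=
      Real.rpow_logb two_pos (by norm_num) (by positivity)
    have h4 : (2 : ℝ) ^ (2 * L) = (1 / p) ^ 2 := by
      rw [mul_comm, Real.rpow_mul zero_le_two, h3, Real.rpow_two]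
    rw [Real.rpow_natCast, h4] at h2
    rw [one_div, inv_pow]
    calc _ ≤ ((1 / p) ^ 2)⁻¹ := inv_anti₀ (by positivity) h2
      _ = p ^ 2 := by rw [one_div, inv_pow, inv_inv]

/-- Many errors few of which are crowded leave many isolated errors. -/
theorem le_card_isolatedErrors {p ε τ X : ℝ} {K n : ℕ} {s : ℕ → EditOp} (hp : 0 < p)
    (hp' : p ≤ 1 / 512) (hε : 0 < ε) (hε' : ε ≤ 1 / 6) (hK : 135 * (K * p) ≤ 19 * ε)
    (hX : 1 ≤ ε * p * (ε * X)) (hτ : τ = 2 * (ε * p * (ε * X)))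
    (hE : (1 - ε) * X < errorCount s n)
    (hB : (crowdedCount (2 * K) s n : ℝ) <
      (Real.exp 1 - 1) * p * recentCount (2 * K) s n + τ) :
    (1 - 2 * ε) * X + 1 ≤ (isolatedErrors (2 * K) s n).card := by
  have hR : (recentCount (2 * K) s n : ℝ) ≤ 2 * K * (errorCount s n + 1) := by
    exact_mod_cast recentCount_le (2 * K) s n
  have hI : (errorCount s n : ℝ) ≤
      (isolatedErrors (2 * K) s n).card + 2 * crowdedCount (2 * K) s n := by
    exact_mod_cast errorCount_le_isolated (2 * K) s n
  have he := Real.exp_one_lt_d9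
  have he0 : (0 : ℝ) ≤ Real.exp 1 - 1 := by linarith [Real.add_one_le_exp (1 : ℝ)]
  set E : ℝ := (errorCount s n : ℝ) with hEdef
  have hE0 : 0 ≤ E := Nat.cast_nonneg _
  have hεp : ε * p ≤ 1 / 3072 := by
    calc ε * p ≤ 1 / 6 * (1 / 512) := mul_le_mul hε' hp' hp.le (by norm_num)
      _ = 1 / 3072 := by norm_num
  have hεX : 3072 ≤ ε * X := by
    by_contra hlt
    push Not at hlt
    have hεp0 : 0 < ε * p := mul_pos hε hp
    have : 0 < ε * X := by
      by_contra h
      have := mul_nonpos_of_nonneg_of_nonpos hεp0.le (not_lt.1 h)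
      linarith
    have := mul_lt_mul_of_le_of_lt_of_pos_of_nonneg hεp hlt hεp0 (by norm_num)
    linarith
  have hτ' : τ ≤ ε * X / 1536 := by
    have := mul_le_mul_of_nonneg_right hεp (show 0 ≤ ε * X by linarith)
    linarith
  -- The 4 combines the distance `2 * K` with the factor 2 on crowded errors. Staying below `ε`
  -- leaves slack `3 / 100 * ε * X`, which absorbs `τ` and the additive constants because `ε * X ≥
  -- 3072`.
  have hκ : 4 * ((Real.exp 1 - 1) * (K * p)) ≤ 97 / 100 * ε := by
    have hKp : 0 ≤ K * p := by positivity
    have : (Real.exp 1 - 1) * (K * p) ≤ 1.7182818286 * (19 / 135 * ε) :=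
      mul_le_mul (by linarith) (by linarith) hKp (by norm_num)
    norm_num at this
    linarith
  have hB2 : 2 * (crowdedCount (2 * K) s n : ℝ) ≤ 97 / 100 * ε * (E + 1) + 2 * τ := by
    have h1 := mul_le_mul_of_nonneg_left hR (mul_nonneg he0 hp.le)
    have h2 := mul_le_mul_of_nonneg_right hκ (show 0 ≤ E + 1 by linarith)
    linarith
  have h3 : (1 - 97 / 100 * ε) * ((1 - ε) * X) ≤ (1 - 97 / 100 * ε) * E :=
    mul_le_mul_of_nonneg_left hE.le (by linarith)
  have h4 : 0 ≤ ε * (ε * X) := mul_nonneg hε.le (by linarith)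
  linarith

/-- For fixed edit operations without an unlikely defect, few strings are close to their trace. -/
theorem card_editDistance_lt_le {α : Type*} [Fintype α] [Nontrivial α] {n K : ℕ} {p ε τ : ℝ}
    {s : ℕ → EditOp} (a : ℕ → α) (hp : 0 < p) (hp' : p ≤ 1 / 512) (hpε : 135 * p ≤ ε)
    (hε' : ε ≤ 1 / 6) (hK : 135 * (K * p) ≤ 19 * ε) (hK2 : ((1 : ℝ) / 2) ^ K ≤ p ^ 2)
    (hX : 1 ≤ ε * p * (ε * (p * n))) (hτ : τ = 2 * (ε * p * (ε * (p * n))))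
    (hE : (1 - ε) * (p * n) < errorCount s n)
    (hB : (crowdedCount (2 * K) s n : ℝ) <
      (Real.exp 1 - 1) * p * recentCount (2 * K) s n + τ) :
    (Nat.card {x : Fin n → α | (editDistance x (indelTrace s a x) : ℝ) < (1 - 6 * ε) * p * n} : ℝ) ≤
      Fintype.card α ^ n * Real.exp (-τ) := by
  have hε : 0 < ε := by linarith
  have hI := le_card_isolatedErrors hp hp' hε hε' hK hX hτ hE hB
  set X : ℝ := p * n with hXdef
  have hX0 : 0 ≤ X := by positivity
  have hεp : ε * p ≤ 1 / 3072 := by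
    calc ε * p ≤ 1 / 6 * (1 / 512) := mul_le_mul hε' hp' hp.le (by norm_num)
      _ = 1 / 3072 := by norm_num
  have hτ' : τ ≤ ε * X / 1536 := by
    have := mul_le_mul_of_nonneg_right hεp (show 0 ≤ ε * X by positivity)
    linarith
  have hεX : 1 ≤ ε * X := by
    have := mul_le_mul_of_nonneg_right hεp (show 0 ≤ ε * X by positivity)
    linarith
  set W : ℕ := ⌊(1 - 2 * ε) * X⌋₊ with hWdef
  set C : ℕ := ⌊(1 - 6 * ε) * X⌋₊ with hCdef
  have hWle : (W : ℝ) ≤ (1 - 2 * ε) * X := Nat.floor_le (mul_nonneg (by linarith) hX0)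
  have hWge : (1 - 2 * ε) * X < W + 1 := Nat.lt_floor_add_one _
  have hCle : (C : ℝ) ≤ (1 - 6 * ε) * X := Nat.floor_le (mul_nonneg (by linarith) hX0)
  have hWI : W + 1 ≤ (isolatedErrors (2 * K) s n).card := by
    have : ((W + 1 : ℕ) : ℝ) ≤ (isolatedErrors (2 * K) s n).card := by
      push_cast
      linarith
    exact_mod_cast this
  obtain ⟨lo, hi, h1, h2, h3, h4⟩ := exists_windows s n K W hWI
  have hmain := card_editDistance_le s a lo hi h1 h2 W K C h3 h4 hε.le
  have hsub : (Nat.card {x : Fin n → α |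
      (editDistance x (indelTrace s a x) : ℝ) < (1 - 6 * ε) * p * n} : ℝ) ≤
      Nat.card {x : Fin n → α | editDistance x (indelTrace s a x) ≤ C} := by
    refine Nat.cast_le.2 (Nat.card_mono (Set.toFinite _) fun x hx => ?_)
    have hx' : (editDistance x (indelTrace s a x) : ℝ) < (1 - 6 * ε) * p * n := hx
    refine Nat.le_floor ?_
    rw [mul_assoc] at hx'
    exact hx'.le
  refine hsub.trans (hmain.trans (mul_le_mul_of_nonneg_left ?_ (by positivity)))
  -- The sum is at most `3 * p ^ 2 * (4 / ε)`, and `135 * p ≤ ε` gives `12000 * p ^ 2 ≤ ε ^ 2`.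
  have hθ : ∑ d ∈ Finset.Icc (-C : ℤ) C,
      (1 / 2) ^ K * Real.exp 1 * Real.exp (-(ε * |d|)) ≤ ε / 1000 := by
    rw [← Finset.mul_sum]
    have e1 := sum_exp_neg_abs_le hε (by linarith) C
    have e2 : ((1 : ℝ) / 2) ^ K * Real.exp 1 ≤ p ^ 2 * 3 :=
      mul_le_mul hK2 (by linarith [Real.exp_one_lt_d9]) (Real.exp_pos 1).le (by positivity)
    refine (mul_le_mul e2 e1 (Finset.sum_nonneg fun d _ => (Real.exp_pos _).le)
      (by positivity)).trans ?_
    rw [mul_div_assoc', div_le_iff₀ hε]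
    nlinarith [mul_le_mul hpε hpε (by positivity) hε.le]
  have hpow : (1 + ∑ d ∈ Finset.Icc (-C : ℤ) C,
      (1 / 2) ^ K * Real.exp 1 * Real.exp (-(ε * |d|))) ^ W ≤ Real.exp (W * (ε / 1000)) := by
    rw [Real.exp_nat_mul]
    refine pow_le_pow_left₀ ?_ ?_ _
    · have : 0 ≤ ∑ d ∈ Finset.Icc (-C : ℤ) C,
          ((1 : ℝ) / 2) ^ K * Real.exp 1 * Real.exp (-(ε * |d|)) := by positivity
      linarith
    · linarith [Real.add_one_le_exp (ε / 1000)]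
  refine (mul_le_mul_of_nonneg_left hpow (Real.exp_pos _).le).trans ?_
  rw [← Real.exp_add, Real.exp_le_exp]
  have f1 : ε * C ≤ ε * X := by
    refine mul_le_mul_of_nonneg_left (hCle.trans ?_) hε.le
    have : 0 ≤ ε * X := by positivity
    linarith
  have f2 : (W : ℝ) * ε ≤ ε * X := by
    rw [mul_comm]
    refine mul_le_mul_of_nonneg_left (hWle.trans ?_) hε.le
    have : 0 ≤ ε * X := by positivity
    linarith
  linarith

/-! ### Measurability -/

theorem dependsOn_pointers (t : ℕ) :
    DependsOn (fun s : ℕ → EditOp => pointers s t) (Finset.range t : Set ℕ) := by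
  intro s s' h
  induction t with
  | zero => rfl
  | succ n ih =>
    have e1 := ih fun i hi => h i (by simp at hi ⊢; omega)
    have e2 := h n (by simp)
    simp only at e1 ⊢
    rw [pointers, pointers, e1, e2]

theorem measurableSet_pointers_eq (t : ℕ) (q : ℕ × ℕ) :
    MeasurableSet {s : ℕ → EditOp | pointers s t = q} :=
  (dependsOn_pointers t).measurable_range (measurableSet_singleton q)

theorem measurableSet_plantedAlignment_eq (i j : ℕ) :
    MeasurableSet {s : ℕ → EditOp | plantedAlignment s i = some j} := by
  have h : {s : ℕ → EditOp | plantedAlignment s i = some j} =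
      ⋃ t, {s | pointers s t = (i, j)} ∩ {s | s t = EditOp.keep} := by
    ext s
    simp [plantedAlignment_eq_some_iff]
  rw [h]
  exact MeasurableSet.iUnion fun t => (measurableSet_pointers_eq t _).inter
    (measurableSet_eq_fun (measurable_pi_apply t) measurable_const)

theorem measurable_outputLength (n : ℕ) : Measurable fun s => outputLength s n := by
  refine measurable_to_countable' fun m => ?_
  let Q : ℕ → Set (ℕ → EditOp) := fun j => ⋃ t, {s | pointers s t = (n, j)}
  have hQ : ∀ j, MeasurableSet (Q j) := fun j =>
    MeasurableSet.iUnion fun t => measurableSet_pointers_eq t _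
  have hmem : ∀ s j, s ∈ Q j ↔ ∃ t, pointers s t = (n, j) := fun s j => by simp [Q]
  -- Step sequences that never bring the input pointer to `n` have output length `sInf ∅ = 0`, so
  -- they belong to the fibre over 0.
  have h : (fun s => outputLength s n) ⁻¹' {m} =
      (Q m ∩ ⋂ j, ⋂ (_ : j < m), (Q j)ᶜ) ∪ ((⋂ j, (Q j)ᶜ) ∩ {_s | m = 0}) := by
    ext s
    simp only [Set.mem_preimage, Set.mem_singleton_iff, Set.mem_union, Set.mem_inter_iff,
      Set.mem_iInter, Set.mem_compl_iff, Set.mem_ofPred_eq, hmem, outputLength]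
    constructor
    · rintro rfl
      by_cases hne : {j : ℕ | ∃ t, pointers s t = (n, j)}.Nonempty
      · exact Or.inl ⟨Nat.sInf_mem hne, fun j hj => Nat.notMem_of_lt_sInf hj⟩
      · rw [Set.not_nonempty_iff_eq_empty] at hne
        refine Or.inr ⟨fun j hj => ?_, by rw [hne, Nat.sInf_empty]⟩
        have : j ∈ {j : ℕ | ∃ t, pointers s t = (n, j)} := hj
        rw [hne] at this
        exact this
    · rintro (⟨h1, h2⟩ | ⟨h1, rfl⟩)
      · refine le_antisymm (Nat.sInf_le h1) (not_lt.1 fun hlt => ?_)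
        exact h2 _ hlt (Nat.sInf_mem (s := {j : ℕ | ∃ t, pointers s t = (n, j)}) ⟨m, h1⟩)
      · rw [Nat.sInf_eq_zero]
        exact Or.inr (Set.eq_empty_of_forall_notMem h1)
  rw [h]
  exact ((hQ m).inter (MeasurableSet.iInter fun j => MeasurableSet.iInter fun _ =>
    (hQ j).compl)).union ((MeasurableSet.iInter fun j => (hQ j).compl).inter (MeasurableSet.const _))

theorem measurable_traceSymbol {α : Type*} [Finite α] [MeasurableSpace α]
    [DiscreteMeasurableSpace α] (n j : ℕ) :
    Measurable fun ω : (ℕ → EditOp) × (ℕ → α) × (Fin n → α) =>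
      traceSymbol (plantedAlignment ω.1) ω.2.1 ω.2.2 j := by
  classical
  let T : (Fin n → Prop) × α × (Fin n → α) → α :=
    fun q => if h : ∃ i : Fin n, q.1 i then q.2.2 h.choose else q.2.1
  have hT1 : ∀ (P : Fin n → Prop) (b : α) (x : Fin n → α) (h : ∃ i : Fin n, P i),
      T (P, b, x) = x h.choose := fun P b x h => dif_pos h
  have hT2 : ∀ (P : Fin n → Prop) (b : α) (x : Fin n → α), (¬ ∃ i : Fin n, P i) →
      T (P, b, x) = b := fun P b x h => dif_neg h
  have hT : Measurable fun ω : (ℕ → EditOp) × (ℕ → α) × (Fin n → α) =>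
      T (fun i => plantedAlignment ω.1 i = some j, ω.2.1 j, ω.2.2) := by
    refine (measurable_of_finite T).comp (Measurable.prodMk ?_ (by fun_prop))
    refine measurable_pi_lambda _ fun i => ?_
    exact (measurableSet_setOfPred.1 (measurableSet_plantedAlignment_eq i j)).comp measurable_fst
  have heq : (fun ω : (ℕ → EditOp) × (ℕ → α) × (Fin n → α) =>
      traceSymbol (plantedAlignment ω.1) ω.2.1 ω.2.2 j) =
      fun ω => T (fun i => plantedAlignment ω.1 i = some j, ω.2.1 j, ω.2.2) := by
    funext ω
    unfold traceSymbol
    by_cases h : ∃ i : Fin n, plantedAlignment ω.1 i = some j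
    · rw [hT1 _ _ _ h, dif_pos h]
    · rw [hT2 _ _ _ h, dif_neg h]
  rw [heq]
  exact hT

theorem measurableSet_editDistance_lt {α : Type*} [Finite α] [MeasurableSpace α]
    [DiscreteMeasurableSpace α] (n : ℕ) (c : ℝ) :
    MeasurableSet {ω : (ℕ → EditOp) × (ℕ → α) × (Fin n → α) |
      (editDistance ω.2.2 (indelTrace ω.1 ω.2.1 ω.2.2) : ℝ) < c} := by
  have h : {ω : (ℕ → EditOp) × (ℕ → α) × (Fin n → α) |
      (editDistance ω.2.2 (indelTrace ω.1 ω.2.1 ω.2.2) : ℝ) < c} =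
      ⋃ m, {ω | outputLength ω.1 n = m} ∩ {ω | (editDistance ω.2.2
        (fun j : Fin m => traceSymbol (plantedAlignment ω.1) ω.2.1 ω.2.2 j) : ℝ) < c} := by
    ext ω
    simp only [Set.mem_ofPred_eq, Set.mem_iUnion, Set.mem_inter_iff, indelTrace_eq]
    constructor
    · exact fun h => ⟨_, rfl, h⟩
    · rintro ⟨m, rfl, h⟩
      exact h
  rw [h]
  refine MeasurableSet.iUnion fun m => MeasurableSet.inter ?_ ?_
  · exact (measurable_outputLength n).comp measurable_fst (measurableSet_singleton m)
  · have hm : Measurable fun ω : (ℕ → EditOp) × (ℕ → α) × (Fin n → α) =>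
        (ω.2.2, fun j : Fin m => traceSymbol (plantedAlignment ω.1) ω.2.1 ω.2.2 j) :=
      Measurable.prodMk (by fun_prop) (measurable_pi_lambda _ fun j => measurable_traceSymbol n j)
    exact hm (Set.toFinite
      {q : (Fin n → α) × (Fin m → α) | (editDistance q.1 q.2 : ℝ) < c}).measurableSet

theorem dependsOn_errorCount (n : ℕ) :
    DependsOn (fun s : ℕ → EditOp => errorCount s n) (Finset.range n : Set ℕ) := by
  classical
  intro s s' h
  refine congrArg Finset.card (Finset.filter_congr fun t ht => ?_)
  rw [h t ht]

theorem dependsOn_recentCount (l n : ℕ) :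
    DependsOn (fun s : ℕ → EditOp => recentCount l s n) (Finset.range n : Set ℕ) := by
  classical
  intro s s' h
  refine congrArg Finset.card (Finset.filter_congr fun t ht => ?_)
  have e1 := dependsOn_keepRun t (x := s) (y := s') fun i hi => h i (by simp at hi ht ⊢; omega)
  simp only at e1
  rw [e1]

theorem dependsOn_crowdedCount (l n : ℕ) :
    DependsOn (fun s : ℕ → EditOp => crowdedCount l s n) (Finset.range n : Set ℕ) := by
  classical
  intro s s' h
  refine congrArg Finset.card (Finset.filter_congr fun t ht => ?_)
  have e1 := dependsOn_keepRun t (x := s) (y := s') fun i hi => h i (by simp at hi ht ⊢; omega)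
  simp only at e1
  rw [e1, h t ht]

/-! ### Combining the estimates -/

/-- A section-wise bound off a small set bounds the measure of a set in a product. -/
theorem measureReal_prod_le {X Y : Type*} [MeasurableSpace X] [MeasurableSpace Y] (μ : Measure X)
    (ν : Measure Y) [IsProbabilityMeasure μ] [IsProbabilityMeasure ν] {G : Set (X × Y)}
    (hG : MeasurableSet G) {B : Set X} (hB : MeasurableSet B) {b : ℝ} (hb : 0 ≤ b)
    (h : ∀ x ∉ B, ν.real (Prod.mk x ⁻¹' G) ≤ b) : (μ.prod ν).real G ≤ μ.real B + b := by
  have key : (μ.prod ν) G ≤ μ B + ENNReal.ofReal b := by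
    rw [Measure.prod_apply hG]
    calc ∫⁻ x, ν (Prod.mk x ⁻¹' G) ∂μ ≤ ∫⁻ x, (B.indicator 1 x + ENNReal.ofReal b) ∂μ := by
          refine lintegral_mono fun x => ?_
          by_cases hx : x ∈ B
          · simp only [Set.indicator_of_mem hx, Pi.one_apply]
            exact prob_le_one.trans le_self_add
          · simp only [Set.indicator_of_notMem hx, zero_add]
            exact (ENNReal.le_ofReal_iff_toReal_le (measure_ne_top _ _) hb).2 (h x hx)
      _ = μ B + ENNReal.ofReal b := by
          rw [lintegral_add_right _ measurable_const, lintegral_indicator_one hB, lintegral_const,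
            measure_univ, mul_one]
  rw [Measure.real, Measure.real]
  refine (ENNReal.toReal_mono (by simp) key).trans ?_
  rw [ENNReal.toReal_add (by simp) (by simp), ENNReal.toReal_ofReal hb]

theorem uniform_real_apply {β : Type*} [Fintype β] [Nonempty β] [MeasurableSpace β]
    [DiscreteMeasurableSpace β] (S : Set β) :
    (PMF.uniformOfFintype β).toMeasure.real S = (Nat.card S : ℝ) / Fintype.card β := by
  classical
  rw [Measure.real, PMF.toMeasure_uniformOfFintype_apply S (MeasurableSet.of_discrete),
    ENNReal.toReal_div, Nat.card_eq_fintype_card]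
  simp

theorem mainTheorem4 (α : Type*) [Fintype α] [Nontrivial α] [MeasurableSpace α]
    [DiscreteMeasurableSpace α] (n : ℕ) (p : unitInterval) (ε : ℝ)
    (hp : 0 < (p : ℝ)) (hpε : (p : ℝ) ≤ ε)
    (hε : 15 * (p : ℝ) * Real.logb 2 (1 / (p : ℝ)) ≤ ε) (hε' : ε ≤ 1 / 6) :
    (modelLaw α p n).real
        {ω | (editDistance ω.2.2 (indelTrace ω.1 ω.2.1 ω.2.2) : ℝ) < (1 - 6 * ε) * (p : ℝ) * (n : ℝ)}
      ≤ 2 * Real.exp (-(ε ^ 2 * (p : ℝ) ^ 2 * (n : ℝ)) / 2) := by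
  have : DiscreteMeasurableSpace (Fin n → α) := inferInstance
  have : IsProbabilityMeasure (PMF.uniformOfFintype α).toMeasure := inferInstance
  have : IsProbabilityMeasure (PMF.uniformOfFintype (Fin n → α)).toMeasure := inferInstance
  set G : Set ((ℕ → EditOp) × (ℕ → α) × (Fin n → α)) :=
    {ω | (editDistance ω.2.2 (indelTrace ω.1 ω.2.1 ω.2.2) : ℝ) < (1 - 6 * ε) * (p : ℝ) * (n : ℝ)}
    with hGdef
  have hε0 : 0 < ε := hp.trans_le hpε
  obtain ⟨hp', hp135, K, hK, hK2⟩ := exists_window_size hp hpε hε hε'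
  set z : ℝ := ε * p * (ε * (p * n)) with hz
  have hz' : -(ε ^ 2 * (p : ℝ) ^ 2 * (n : ℝ)) / 2 = -(z / 2) := by rw [hz]; ring
  rw [hz']
  have hexp1 : Real.exp 1 ≤ 2.7182818286 := Real.exp_one_lt_d9.le
  -- For `z < 1` the claimed bound is at least 1. Otherwise `1 ≤ z` supplies the size condition used
  -- in the counting.
  by_cases hz1 : z < 1
  · have h1 : (modelLaw α p n).real G ≤ 1 := by
      unfold modelLaw
      exact measureReal_le_one
    have h2 : 1 / 2 ≤ Real.exp (-(z / 2)) := by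
      have := Real.add_one_le_exp (-(z / 2))
      linarith
    linarith
  push Not at hz1
  set τ : ℝ := 2 * z with hτ
  have hz0 : 0 < z := by linarith
  set B : Set (ℕ → EditOp) := {s | (errorCount s n : ℝ) ≤ (1 - ε) * (p * n)} ∪
    {s | (Real.exp 1 - 1) * p * recentCount (2 * K) s n + τ ≤ crowdedCount (2 * K) s n} with hB
  have hBm : MeasurableSet B := by
    have m1 : Measurable fun s : ℕ → EditOp => errorCount s n :=
      (dependsOn_errorCount n).measurable_range
    have m2 : Measurable fun s : ℕ → EditOp => recentCount (2 * K) s n :=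
      (dependsOn_recentCount _ n).measurable_range
    have m3 : Measurable fun s : ℕ → EditOp => crowdedCount (2 * K) s n :=
      (dependsOn_crowdedCount _ n).measurable_range
    have m1' : Measurable fun s : ℕ → EditOp => (errorCount s n : ℝ) :=
      measurable_from_nat.comp m1
    have m2' : Measurable fun s : ℕ → EditOp => (recentCount (2 * K) s n : ℝ) :=
      measurable_from_nat.comp m2
    have m3' : Measurable fun s : ℕ → EditOp => (crowdedCount (2 * K) s n : ℝ) :=
      measurable_from_nat.comp m3
    exact (measurableSet_le m1' measurable_const).union
      (measurableSet_le ((m2'.const_mul _).add_const _) m3')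
  have hBle : (editOpsLaw p).real B ≤ Real.exp (-τ) + Real.exp (-τ) := by
    refine (measureReal_union_le _ _).trans (add_le_add ?_ ?_)
    · refine (measureReal_errorCount_le p n hε0.le).trans (Real.exp_le_exp.2 (neg_le_neg ?_))
      have hX : 0 ≤ ε ^ 2 * (p * n) := by positivity
      have := mul_le_mul_of_nonneg_right hp' hX
      rw [hτ, hz]
      linarith
    · exact measureReal_crowdedCount_ge p n (2 * K) τ
  have hG : MeasurableSet G := measurableSet_editDistance_lt n _
  have hmain : (modelLaw α p n).real G ≤ (editOpsLaw p).real B + Real.exp (-τ) := by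
    refine measureReal_prod_le _ _ hG hBm (Real.exp_pos _).le fun s hs => ?_
    have hs1 : (1 - ε) * (p * n) < errorCount s n := not_le.1 fun h => hs (Or.inl h)
    have hs2 : (crowdedCount (2 * K) s n : ℝ) <
        (Real.exp 1 - 1) * p * recentCount (2 * K) s n + τ := not_le.1 fun h => hs (Or.inr h)
    -- The count is uniform in the inserted symbols, so no exceptional set of them is needed.
    have := measureReal_prod_le (Measure.infinitePi fun _ : ℕ => (PMF.uniformOfFintype α).toMeasure)
      (PMF.uniformOfFintype (Fin n → α)).toMeasure (measurable_prodMk_left (x := s) hG)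
      MeasurableSet.empty (Real.exp_pos (-τ)).le fun a _ => ?_
    · simpa using this
    · rw [uniform_real_apply, div_le_iff₀ (by exact_mod_cast Fintype.card_pos), mul_comm,
        Fintype.card_fun, Fintype.card_fin]
      push_cast
      exact card_editDistance_lt_le a hp hp' hp135 hε' hK hK2 hz1 hτ hs1 hs2
  -- Three terms `exp (-τ)` arise: too few errors, too many crowded ones, and the count of strings.
  -- As `τ = 2 * z` with `z ≥ 1`, each is at most `2 / 3 * exp (-(z / 2))`.
  have h3 : Real.exp (-τ) = Real.exp (-(z / 2)) * Real.exp (-(3 * z / 2)) := by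
    rw [← Real.exp_add, hτ]
    congr 1
    ring
  have h4 : Real.exp (-(3 * z / 2)) ≤ 2 / 3 := by
    have h5 := Real.add_one_le_exp (3 * z / 2)
    rw [Real.exp_neg, inv_le_comm₀ (Real.exp_pos _) (by norm_num)]
    linarith
  have h6 := mul_le_mul_of_nonneg_left h4 (Real.exp_pos (-(z / 2))).le
  linarith
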